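/- **Theorem.** Let $M$ be a smooth finite-dimensional manifold without boundary, with projections $\tau_M:TM\to M$, $\pi_M:T^*M\to M$. Let $\theta_M$ be the Liouville one-form on $T^*M$, $\langle(\theta_M)_\epsilon,X\rangle=\langle\epsilon,T\pi_M(X)\rangle$, and $\omega_M=-d\theta_M$; similarly $\omega_{TM}$ on $T^*TM$. For a smooth $H:T^*M\to\mathbb R$ let $\mathbb FH:T^*M\to TM$ be the fibre derivative, $\langle\beta_q,\mathbb FH(\alpha_q)\rangle=\frac{d}{dt}\big|_{t=0}H(\alpha_q+t\beta_q)$ for $\alpha_q,\beta_q\in T^*_qM$, and put $(\Delta^*H)(\alpha_q)=\frac{d}{dt}\big|_{t=0}H(e^t\alpha_q)$, so locally $\Delta^*H=p_i\,\partial H/\partial p_i$. Let $\alpha_M:TT^*M\to T^*TM$ be the Tulczyjew isomorphism, $\langle\alpha_M(z),w\rangle=\langle z,\kappa_M(w)\rangle^T$, where $\kappa_M$ is the canonical flip of $TTM$ and $\langle\cdot,\cdot\rangle^T$ is the tangent of the duality pairing; in induced coordinates $\alpha_M(q,p,\dot q,\dot p)=(q,\dot q,\dot p,p)$. Assume that $H$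 is almost-regular: $C=\mathbb FH(T^*M)$ is a submanifold of $TM$, with inclusion $i_C:C\hookrightarrow TM$, and $\mathbb FH:T^*M\to C$ is a submersion with connected fibres. Then: 1. There is a unique vector field $X_H$ on $T^*M$ with $i_{X_H}\omega_M=dH$. 2. There is a unique function $L:C\to\mathbb R$ with $L\circ\mathbb FH=\Delta^*H-H$, and $L$ is smooth. 3. The set $\Sigma_L=\{\mu\in T^*TM:\ \pi_{TM}(\mu)\in C,\ i_C^*\mu=dL\}$ (that is, $\langle\mu,v\rangle=\langle dL,v\rangle$ for all $v\in T_{\pi_{TM}(\mu)}C$) is a Lagrangian submanifold of $(T^*TM,\omega_{TM})$, and $$\alpha_M\bigl(X_H(T^*M)\bigr)=\Sigma_L .$$ Equivalently, $\alpha_M^{-1}(\Sigma_L)=X_H(T^*M)$: the constrained variational (vakonomic) dynamics $\alpha_M^{-1}(\Sigma_L)\subset TT^*M$ defined by $(C,L)$ is the Hamiltonian dynamics of $H$. -/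

import Mathlib

open Set Bundle Manifold
open scoped Manifold ContDiff Topology

noncomputable section

namespace Tulczyjew

section Generic

variable {E : Type*} [NormedAddCommGroup E] [NormedSpace ℝ E]
  {H : Type*} [TopologicalSpace H]

/-- The cotangent space `T*_x N`. -/
abbrev CotangentSpace (I : ModelWithCorners ℝ E H) {N : Type*} [TopologicalSpace N]
    [ChartedSpace H N] (x : N) : Type _ :=
  TangentSpace I x →L[ℝ] Bundle.Trivial N ℝ x

/-- The cotangent bundle `T*N`: the bundle of continuous linear maps from the tangent bundle to the
trivial line bundle, with Mathlib's smooth vector bundle structure. -/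
abbrev CotangentBundle (I : ModelWithCorners ℝ E H) (N : Type*) [TopologicalSpace N]
    [ChartedSpace H N] : Type _ :=
  TotalSpace (E →L[ℝ] ℝ) (fun x : N => CotangentSpace I x)

/-- The model with corners of `T*N`. -/
abbrev cotModel (I : ModelWithCorners ℝ E H) :
    ModelWithCorners ℝ (E × (E →L[ℝ] ℝ)) (ModelProd H (E →L[ℝ] ℝ)) :=
  I.prod 𝓘(ℝ, E →L[ℝ] ℝ)

variable (I : ModelWithCorners ℝ E H) {N : Type*} [TopologicalSpace N] [ChartedSpace H N]

/-- The differential `df_x ∈ T*_x N` of a real function. -/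
def differential (f : N → ℝ) (x : N) : CotangentSpace I x :=
  mfderiv I 𝓘(ℝ, ℝ) f x

/-- The velocity vector `d/dt c(t) ∈ TN` of a curve at time `t`. -/
def velocity (c : ℝ → N) (t : ℝ) : TangentBundle I N :=
  ⟨c t, mfderiv 𝓘(ℝ, ℝ) I c t (1 : ℝ)⟩

/-- The exterior derivative `dα_x(u, v)` of a one-form on a manifold without boundary, computed in
the chart at `x`: if `a` is the one-form on the model space that represents `α`, then
`da(u, v) = (D a · u) v - (D a · v) u`. -/
def extDerivOneForm (α : ∀ x : N, CotangentSpace I x) (x : N) (u v : TangentSpace I x) : ℝ :=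
  let a : E → E →L[ℝ] ℝ := fun y =>
    (α ((extChartAt I x).symm y)).comp (mfderiv 𝓘(ℝ, E) I (extChartAt I x).symm y)
  let D : TangentSpace I x →L[ℝ] E := mfderiv I 𝓘(ℝ, E) (extChartAt I x) x
  fderiv ℝ a (extChartAt I x x) (D u) (D v) - fderiv ℝ a (extChartAt I x x) (D v) (D u)

/-- A subset `S` of a manifold `P` with two-form `Ω` is a Lagrangian submanifold: around each of its
points there is a chart `e` of the maximal smooth atlas in which `S` is a linear slice `W` of half
the dimension of `P` (so that `T_y S` is the preimage of `W` under the differential of the chart),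
and `Ω` vanishes on the tangent spaces of `S`. -/
def IsLagrangianSubmanifold (Ω : ∀ x : N, TangentSpace I x → TangentSpace I x → ℝ)
    (S : Set N) : Prop :=
  ∀ x ∈ S, ∃ e ∈ IsManifold.maximalAtlas I ∞ N, x ∈ e.source ∧ ∃ W : Submodule ℝ E,
    2 * Module.finrank ℝ W = Module.finrank ℝ E ∧
    (∀ y ∈ e.source, y ∈ S ↔ e.extend I y ∈ W) ∧
    ∀ y ∈ e.source, y ∈ S → ∀ u v : TangentSpace I y,
      (mfderiv I 𝓘(ℝ, E) (e.extend I) y u : E) ∈ W →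
      (mfderiv I 𝓘(ℝ, E) (e.extend I) y v : E) ∈ W → Ω y u v = 0

variable [IsManifold I ∞ N]

/-- The Liouville one-form `θ_N` on `T*N`: `⟨θ_ε, X⟩ = ⟨ε, Tπ(X)⟩`. -/
def liouvilleForm (ε : CotangentBundle I N) : CotangentSpace (cotModel I) ε :=
  ContinuousLinearMap.comp (M₂ := TangentSpace I ε.proj) ε.snd
    (mfderiv (cotModel I) I (TotalSpace.proj : CotangentBundle I N → N) ε)

/-- The canonical symplectic form `ω_N = -dθ_N` on `T*N`. -/
def canonicalForm (ε : CotangentBundle I N) (u v : TangentSpace (cotModel I) ε) : ℝ :=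
  -extDerivOneForm (cotModel I) (liouvilleForm I) ε u v

/-- `X` is the Hamiltonian vector field of `h : T*N → ℝ`: `i_X ω_N = dh`. -/
def IsHamiltonianVectorField (h : CotangentBundle I N → ℝ)
    (X : ∀ ε : CotangentBundle I N, TangentSpace (cotModel I) ε) : Prop :=
  ∀ (ε : CotangentBundle I N) (v : TangentSpace (cotModel I) ε),
    canonicalForm I ε (X ε) v = differential (cotModel I) h ε v

/-- The image `X(P) ⊂ TP` of a vector field on `P`. -/
def vectorFieldImage (X : ∀ x : N, TangentSpace I x) : Set (TangentBundle I N) :=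
  range fun x => (⟨x, X x⟩ : TangentBundle I N)

/-- For a submanifold `C` of `N` with inclusion `ι` and `f : C → ℝ`, the set
`Σ_f = {μ ∈ T*N : π(μ) ∈ C, ι^*μ = df}`. -/
def generatedSet {F : Type*} [NormedAddCommGroup F] [NormedSpace ℝ F] {G : Type*}
    [TopologicalSpace G] (J : ModelWithCorners ℝ F G) {C : Type*} [TopologicalSpace C]
    [ChartedSpace G C] (ι : C → N) (f : C → ℝ) : Set (CotangentBundle I N) :=
  {μ | ∃ (c : C) (ν : CotangentSpace I (ι c)), μ = ⟨ι c, ν⟩ ∧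
    ∀ u : TangentSpace J c, ν (mfderiv J I ι c u) = differential J f c u}

/-- The derivative of `h : T*N → ℝ` at `ε` along the generator of the dilations `μ ↦ eᵗ μ` of the
fibres. -/
def dilationDeriv (h : CotangentBundle I N → ℝ) (ε : CotangentBundle I N) : ℝ :=
  deriv (fun t : ℝ => h ⟨ε.proj, Real.exp t • ε.snd⟩) 0

/-- The fibre derivative `𝔽h : T*N → TN`: `𝔽h(ε) ∈ T_q N` is the vector with
`⟨β, 𝔽h(ε)⟩ = d/dt h(ε + t β)` at `t = 0` for all `β ∈ T*_q N`. -/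
def fiberDeriv (h : CotangentBundle I N → ℝ) (ε : CotangentBundle I N) : TangentBundle I N :=
  ⟨ε.proj, Classical.epsilon fun v : TangentSpace I ε.proj =>
    ∀ β : CotangentSpace I ε.proj, β v = deriv (fun t : ℝ => h ⟨ε.proj, ε.snd + t • β⟩) 0⟩

/-! In Mathlib, the tangent space of a manifold at a point is the model vector space, through the
preferred chart at that point; the preferred charts of `TN` and of `T*N` at a point over `q` are
those induced by the preferred chart at `q`. A pair in a tangent space of `TN` or of `T*N` is
therefore the pair of its components in the induced coordinates. -/

/-- The canonical flip `κ : TTN → TTN`, `(q, v, q̇, v̇) ↦ (q, q̇, v, v̇)`. -/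
def canonicalFlip (w : TangentBundle I.tangent (TangentBundle I N)) :
    TangentBundle I.tangent (TangentBundle I N) :=
  ⟨⟨w.proj.proj, (w.snd : E × E).1⟩, ((w.proj.snd, (w.snd : E × E).2) : E × E)⟩

/-- The tangent pairing of `z = (q, p, q̇, ṗ) ∈ TT*N` and `w = (q, v, q̇, v̇) ∈ TTN` over the same
vector `(q, q̇) ∈ TN`: the derivative `⟨ṗ, v⟩ + ⟨p, v̇⟩` of the duality pairing. -/
def tangentPairing (z : TangentBundle (cotModel I) (CotangentBundle I N))
    (w : TangentBundle I.tangent (TangentBundle I N)) : ℝ :=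
  (z.snd : E × (E →L[ℝ] ℝ)).2 (w.proj.snd : E) + (z.proj.snd : E →L[ℝ] ℝ) (w.snd : E × E).2

/-- Tulczyjew's map `α : TT*N → T*TN`: `α(z)` is the covector at `Tπ(z)` with
`⟨α(z), w⟩ = ⟨z, κ(w)⟩^T`. -/
def alpha (z : TangentBundle (cotModel I) (CotangentBundle I N)) :
    CotangentBundle I.tangent (TangentBundle I N) :=
  ⟨⟨z.proj.proj, (z.snd : E × (E →L[ℝ] ℝ)).1⟩,
    { toFun := fun w => tangentPairing I z (canonicalFlip I ⟨_, w⟩)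
      map_add' := fun w w' => by
        simp only [tangentPairing, canonicalFlip]
        have h1 : (z.snd : E × (E →L[ℝ] ℝ)).2 ((w + w' : E × E)).1 =
          (z.snd : E × (E →L[ℝ] ℝ)).2 (w : E × E).1 + (z.snd : E × (E →L[ℝ] ℝ)).2 (w' : E × E).1 :=
          map_add _ _ _
        have h2 : (z.proj.snd : E →L[ℝ] ℝ) ((w + w' : E × E)).2 =
          (z.proj.snd : E →L[ℝ] ℝ) (w : E × E).2 + (z.proj.snd : E →L[ℝ] ℝ) (w' : E × E).2 :=
          map_add _ _ _
        exact (congrArg₂ (· + ·) h1 h2).trans (add_add_add_comm _ _ _ _)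
      map_smul' := fun r w => by
        have h1 : (z.snd : E × (E →L[ℝ] ℝ)).2 ((r • w : E × E)).1 =
          r • (z.snd : E × (E →L[ℝ] ℝ)).2 (w : E × E).1 := map_smul _ _ _
        have h2 : (z.proj.snd : E →L[ℝ] ℝ) ((r • w : E × E)).2 =
          r • (z.proj.snd : E →L[ℝ] ℝ) (w : E × E).2 := map_smul _ _ _
        exact (congrArg₂ (· + ·) h1 h2).trans (smul_add _ _ _).symm
      cont :=
        (((z.snd : E × (E →L[ℝ] ℝ)).2).continuous.comp continuous_fst).add
          ((z.proj.snd : E →L[ℝ] ℝ).continuous.comp continuous_snd) }⟩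


/-- The preferred chart of `TN` in terms of the chart of the base point. -/
theorem extChartAt_tangent (a y : TangentBundle I N) :
    extChartAt I.tangent a y = ((extChartAt I a.proj y.proj,
      (trivializationAt E (TangentSpace I) a.proj y).2) : E × E) := by
  rw [FiberBundle.extChartAt]
  rfl

/-- The preferred chart of `T*N` in terms of the chart of the base point. -/
theorem extChartAt_cot (a y : CotangentBundle I N) :
    extChartAt (cotModel I) a y = (extChartAt I a.proj y.proj,
      (y.snd : E →L[ℝ] ℝ).comp ((trivializationAt E (TangentSpace I) a.proj).symmL ℝ y.proj : E →L[ℝ] E)) := by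
  simp only [extChartAt, OpenPartialHomeomorph.extend_coe, Function.comp_apply, hom_chart]
  ext
  · rfl
  · simp [ContinuousLinearMap.inCoordinates]

theorem velocity_snd (c : ℝ → N) (t : ℝ) (hc : MDifferentiableAt 𝓘(ℝ,ℝ) I c t) :
   HasDerivAt (fun s => extChartAt I (c t) (c s)) ((velocity I c t).snd : E) t := by
  have := hc.hasMFDerivAt.2
  simp only [writtenInExtChartAt, extChartAt_model_space_eq_id, PartialEquiv.refl_coe, PartialEquiv.refl_symm, modelWithCornersSelf_coe, range_id, Function.comp_id] at this
  exact HasFDerivAt.hasDerivAt (hasFDerivWithinAt_univ.1 this)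

theorem symmL_self (q : N) : ((trivializationAt E (TangentSpace I) q).symmL ℝ q : E →L[ℝ] E) = ContinuousLinearMap.id ℝ E := by
  have := TangentBundle.symmL_trivializationAt_eq_core (I := I) (mem_chart_source H q)
  erw [this]
  ext v
  exact (tangentBundleCore I N).coordChange_self _ _ (mem_chart_source H q) _

theorem triv_self (q : N) (v : TangentSpace I q) :
   (trivializationAt E (TangentSpace I) q (⟨q, v⟩ : TangentBundle I N)).2 = v :=
  (tangentBundleCore I N).coordChange_self _ _ (mem_chart_source H q) _

/-- The tangent pairing is the derivative of the duality pairing along a pair of curves over the same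
base curve. -/
theorem tangentPairing_velocity (σ : ℝ → N) (p : ∀ t, CotangentSpace I (σ t))
    (v : ∀ t, TangentSpace I (σ t))
    (hp : MDifferentiableAt 𝓘(ℝ, ℝ) (cotModel I) (fun t => (⟨σ t, p t⟩ : CotangentBundle I N)) 0)
    (hv : MDifferentiableAt 𝓘(ℝ, ℝ) I.tangent (fun t => (⟨σ t, v t⟩ : TangentBundle I N)) 0) :
    HasDerivAt (fun t => (p t (v t) : ℝ))
      (tangentPairing I (velocity (cotModel I) (fun t => (⟨σ t, p t⟩ : CotangentBundle I N)) 0)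
        (velocity I.tangent (fun t => (⟨σ t, v t⟩ : TangentBundle I N)) 0)) 0 := by
  have h1 := velocity_snd (cotModel I) _ 0 hp
  have h2 := velocity_snd I.tangent _ 0 hv
  have hσ : ContinuousAt σ 0 :=
    (FiberBundle.continuous_proj E (TangentSpace I : N → Type _)).continuousAt.comp hv.continuousAt
  simp only [extChartAt_cot] at h1
  simp only [extChartAt_tangent] at h2
  have h1' := (ContinuousLinearMap.snd ℝ E (E →L[ℝ] ℝ)).hasFDerivAt.comp_hasDerivAt 0 h1
  have h2' := (ContinuousLinearMap.snd ℝ E E).hasFDerivAt.comp_hasDerivAt 0 h2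
  have h3 := h1'.clm_apply h2'
  simp only [Function.comp_apply, ContinuousLinearMap.coe_snd', triv_self] at h3
  erw [symmL_self] at h3
  refine HasDerivAt.congr_of_eventuallyEq (h3.congr_deriv ?_) ?_
  · rfl
  · have : ∀ᶠ t in 𝓝 (0:ℝ), σ t ∈ (trivializationAt E (TangentSpace I) (σ 0)).baseSet :=
      hσ ((trivializationAt E (TangentSpace I) (σ 0)).open_baseSet.mem_nhds
        (FiberBundle.mem_baseSet_trivializationAt' _))
    filter_upwards [this] with t ht
    have := (trivializationAt E (TangentSpace I : N → Type _) (σ 0)).symmL_continuousLinearMapAt (R := ℝ) ht (v t)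
    rw [Trivialization.continuousLinearMapAt_apply, Trivialization.linearMapAt_apply, if_pos ht] at this
    exact congrArg (p t) this.symm

theorem hasMFDerivAt_proj_cot  (a : CotangentBundle I N) :
      HasMFDerivAt (cotModel I) I (TotalSpace.proj : CotangentBundle I N → N) a
       (ContinuousLinearMap.fst ℝ E (E →L[ℝ] ℝ)) := by
  refine ⟨(FiberBundle.continuous_proj _ _).continuousAt, ?_⟩
  have : HasFDerivWithinAt (Prod.fst : E × (E →L[ℝ] ℝ) → E) (ContinuousLinearMap.fst ℝ E (E →L[ℝ] ℝ)) (range (cotModel I)) (extChartAt (cotModel I) a a) := hasFDerivWithinAt_fst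
  refine this.congr_of_eventuallyEq ?_ ?_
  · filter_upwards [extChartAt_target_mem_nhdsWithin a] with y hy
    have := (extChartAt (cotModel I) a).right_inv hy
    rw [extChartAt_cot] at this
    exact congrArg Prod.fst this
  · simp only [writtenInExtChartAt, Function.comp_apply, extChartAt_to_inv]
    rw [extChartAt_cot]

/-- `α` covers `Tπ`. -/
theorem alpha_proj (z : TangentBundle (cotModel I) (CotangentBundle I N)) :
    (alpha I z).proj =
      tangentMap (cotModel I) I (TotalSpace.proj : CotangentBundle I N → N) z := by
  rw [tangentMap, (hasMFDerivAt_proj_cot I z.proj).mfderiv]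
  rfl

/-- The vector that defines the fibre derivative exists, for smooth `h` on a finite-dimensional
manifold. -/
theorem fiberDeriv_spec [FiniteDimensional ℝ E] {h : CotangentBundle I N → ℝ}
    (hh : ContMDiff (cotModel I) 𝓘(ℝ, ℝ) ∞ h) (ε : CotangentBundle I N)
    (β : CotangentSpace I ε.proj) :
    β (fiberDeriv I h ε).snd = deriv (fun t : ℝ => h ⟨ε.proj, ε.snd + t • β⟩) 0 := by
  have key : ∃ v : TangentSpace I ε.proj,
    ∀ β : CotangentSpace I ε.proj, β v = deriv (fun t : ℝ => h ⟨ε.proj, ε.snd + t • β⟩) 0 := by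
    have hf : ContMDiff 𝓘(ℝ, E →L[ℝ] ℝ) (cotModel I) ∞
        (fun p : E →L[ℝ] ℝ => (⟨ε.proj, p⟩ : CotangentBundle I N)) := by
      intro p
      rw [contMDiffAt_hom_bundle]
      refine ⟨contMDiffAt_const, ?_⟩
      refine (contMDiffAt_id (I := 𝓘(ℝ, E →L[ℝ] ℝ))).congr_of_eventuallyEq (Filter.Eventually.of_forall fun p => ?_)
      simp [ContinuousLinearMap.inCoordinates]
      have := symmL_self I ε.proj
      exact (congrArg (ContinuousLinearMap.comp p) this).trans (ContinuousLinearMap.comp_id p)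
    have hd : Differentiable ℝ (fun p : E →L[ℝ] ℝ => h ⟨ε.proj, p⟩) :=
      (hh.comp hf).contDiff.differentiable (by simp)
    have hβ : ∀ β : CotangentSpace I ε.proj, deriv (fun t : ℝ => h ⟨ε.proj, ε.snd + t • β⟩) 0 =
        fderiv ℝ (fun p : E →L[ℝ] ℝ => h ⟨ε.proj, p⟩) ε.snd β := by
      intro β
      exact ((hd ε.snd).hasFDerivAt.hasLineDerivAt β).lineDeriv
    let ℓ : Module.Dual ℝ (Module.Dual ℝ E) := (fderiv ℝ (fun p : E →L[ℝ] ℝ => h ⟨ε.proj, p⟩) ε.snd).toLinearMap ∘ₗ (LinearMap.toContinuousLinearMap (𝕜 := ℝ) (E := E) (F' := ℝ)).toLinearMap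
    refine ⟨(Module.evalEquiv ℝ E).symm ℓ, fun β => ?_⟩
    refine Eq.trans ?_ (hβ β).symm
    have := congrArg (fun f => f (β : E →L[ℝ] ℝ).toLinearMap) ((Module.evalEquiv ℝ E).apply_symm_apply ℓ)
    exact this
  exact Classical.epsilon_spec key β

theorem triv_velocity (q : N) (c : ℝ → N) (t : ℝ) (hc : MDifferentiableAt 𝓘(ℝ, ℝ) I c t)
    (hq : c t ∈ (chartAt H q).source) {w : E}
    (hw : HasDerivAt (fun s => extChartAt I q (c s)) w t) :
    (trivializationAt E (TangentSpace I) q (velocity I c t)).2 = w := by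
  have e1 := congrArg (fun L => L (velocity I c t).snd)
    (TangentBundle.continuousLinearMapAt_trivializationAt (I := I) hq)
  have e2 : (trivializationAt E (TangentSpace I) q (velocity I c t)).2
      = mfderiv I 𝓘(ℝ, E) (extChartAt I q) (c t) (velocity I c t).snd := by
    have e3 (v : TangentSpace I (c t)) : (trivializationAt E (TangentSpace I) q ⟨c t, v⟩).2 =
        (trivializationAt E (TangentSpace I) q).continuousLinearMapAt ℝ (c t) v := by
      rw [Trivialization.continuousLinearMapAt_apply, Trivialization.linearMapAt_apply,
        if_pos (by simpa using hq)]
    exact (e3 _).trans e1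
  have c3 := mfderiv_comp t (mdifferentiableAt_extChartAt (I := I) hq) hc
  have c8 : mfderiv 𝓘(ℝ, ℝ) 𝓘(ℝ, E) (extChartAt I q ∘ c) t = ContinuousLinearMap.toSpanSingleton ℝ w :=
    hw.hasFDerivAt.hasMFDerivAt.mfderiv
  refine e2.trans ((congrArg (fun L => L (1:ℝ)) c3).symm.trans
    ((congrArg (fun L => L (1:ℝ)) c8).trans ?_))
  exact one_smul ℝ w

theorem velocity_velocity (χ : ℝ × ℝ → N) (hχ : ContMDiff 𝓘(ℝ, ℝ × ℝ) I ∞ χ) (a b : ℝ × ℝ) :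
   let g : ℝ × ℝ → E := fun x => extChartAt I (χ 0) (χ x)
   velocity I.tangent (fun s : ℝ => velocity I (fun t : ℝ => χ (s • a + t • b)) 0) 0 =
     ⟨⟨χ ((0:ℝ) • a + (0 : ℝ) • b), fderiv ℝ g 0 b⟩, ((fderiv ℝ g 0 a, fderiv ℝ (fderiv ℝ g) 0 a b) : E × E)⟩ := by
  intro g
  have hg : ContDiffAt ℝ ∞ g 0 :=
    ((contMDiffAt_extChartAt (I := I) (n := ∞) (x := χ 0)).comp 0 hχ.contMDiffAt).contDiffAt
  have hχd := hχ.mdifferentiable (by simp)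
  have hev : ∀ᶠ s in 𝓝 (0 : ℝ), χ (s • a) ∈ (chartAt H (χ 0)).source := by
    have : ContinuousAt (fun s : ℝ => χ (s • a)) 0 := (hχ.continuous.comp (by fun_prop)).continuousAt
    exact this ((chartAt H (χ 0)).open_source.mem_nhds (by simp))
  have c1 (s : ℝ) : MDifferentiableAt 𝓘(ℝ,ℝ) I (fun t : ℝ => χ (s • a + t • b)) 0 :=
    (hχd _).comp (0:ℝ) (show Differentiable ℝ (fun t : ℝ => s • a + t • b) by fun_prop).mdifferentiable.mdifferentiableAt
  have htriv : ∀ s : ℝ, χ (s • a) ∈ (chartAt H (χ 0)).source →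
     (trivializationAt E (TangentSpace I) (χ 0) (velocity I (fun t : ℝ => χ (s • a + t • b)) 0)).2 = fderiv ℝ g (s • a) b := by
    intro s hs
    have hs' : χ (s • a + (0:ℝ) • b) ∈ (chartAt H (χ 0)).source := by simpa using hs
    refine triv_velocity I (χ 0) _ 0 (c1 s) hs' ?_
    have c4 : MDifferentiableAt 𝓘(ℝ, ℝ × ℝ) 𝓘(ℝ, E) g (s • a) :=
      (mdifferentiableAt_extChartAt hs).comp _ (hχd _)
    have c5 : HasDerivAt (fun t : ℝ => s • a + t • b) b 0 := by
      simpa using ((hasDerivAt_id (0:ℝ)).smul_const b).const_add (s • a)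
    have c6 : HasFDerivAt g (fderiv ℝ g (s • a)) (s • a + (0:ℝ) • b) := by
      simpa using c4.differentiableAt.hasFDerivAt
    exact c6.comp_hasDerivAt (0:ℝ) c5
  have hG : HasDerivAt (fun s : ℝ => fderiv ℝ g (s • a) b) (fderiv ℝ (fderiv ℝ g) 0 a b) 0 := by
    have d1 : HasFDerivAt (fderiv ℝ g) (fderiv ℝ (fderiv ℝ g) 0) ((0:ℝ) • a) := by
      rw [zero_smul]
      exact ((hg.fderiv_right (m := 1) (by norm_cast)).differentiableAt (by simp)).hasFDerivAt
    have d2 : HasDerivAt (fun s : ℝ => s • a) a 0 := by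
      simpa using (hasDerivAt_id (0:ℝ)).smul_const a
    have d3 := (ContinuousLinearMap.apply ℝ E b).hasFDerivAt.comp_hasDerivAt (0:ℝ)
      (d1.comp_hasDerivAt (0:ℝ) d2)
    exact d3
  have h0 : χ ((0:ℝ) • a + (0:ℝ) • b) = χ 0 := by simp
  have hδ : MDifferentiableAt 𝓘(ℝ,ℝ) I.tangent (fun s : ℝ => velocity I (fun t : ℝ => χ (s • a + t • b)) 0) 0 := by
    rw [mdifferentiableAt_totalSpace]
    constructor
    · exact (hχd _).comp (0:ℝ) (show Differentiable ℝ (fun s : ℝ => s • a + (0:ℝ) • b) by fun_prop).mdifferentiable.mdifferentiableAt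
    · have : (velocity I (fun t : ℝ => χ ((0:ℝ) • a + t • b)) 0).proj = χ 0 := h0
      rw [this]
      refine (hG.differentiableAt.mdifferentiableAt).congr_of_eventuallyEq ?_
      filter_upwards [hev] with s hs using htriv s hs
  have h1 := velocity_snd I.tangent _ 0 hδ
  simp only [extChartAt_tangent] at h1
  have hb : (velocity I (fun t : ℝ => χ ((0:ℝ) • a + t • b)) 0).snd = fderiv ℝ g 0 b := by
    have h1 := htriv 0 (by simp)
    rw [show fderiv ℝ g ((0:ℝ) • a) = fderiv ℝ g 0 by rw [zero_smul], ← h0] at h1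
    exact (triv_self I (χ ((0:ℝ) • a + (0:ℝ) • b)) _).symm.trans h1
  have hfst : HasDerivAt (fun s : ℝ => g (s • a)) (fderiv ℝ g 0 a) 0 := by
    have d1 : HasFDerivAt g (fderiv ℝ g 0) ((0:ℝ) • a) := by
      rw [zero_smul]
      exact (hg.differentiableAt (by simp)).hasFDerivAt
    have d2 : HasDerivAt (fun s : ℝ => s • a) a 0 := by
      simpa using (hasDerivAt_id (0:ℝ)).smul_const a
    exact d1.comp_hasDerivAt (0:ℝ) d2
  have h2 : HasDerivAt (fun s : ℝ => ((extChartAt I (velocity I (fun t : ℝ => χ ((0:ℝ) • a + t • b)) 0).proj (velocity I (fun t : ℝ => χ (s • a + t • b)) 0).proj, (trivializationAt E (TangentSpace I) (velocity I (fun t : ℝ => χ ((0:ℝ) • a + t • b)) 0).proj (velocity I (fun t : ℝ => χ (s • a + t • b)) 0)).2) : E × E)) ((fderiv ℝ g 0 a, fderiv ℝ (fderiv ℝ g) 0 a b) : E × E) 0 := by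
    have e : (velocity I (fun t : ℝ => χ ((0:ℝ) • a + t • b)) 0).proj = χ 0 := h0
    rw [e]
    refine (hfst.prodMk hG).congr_of_eventuallyEq ?_
    filter_upwards [hev] with s hs
    refine Prod.ext ?_ (htriv s hs)
    simp [g, velocity]
  have h3 := h1.unique h2
  refine congrArg₂ (fun (x : E) (y : E × E) => (⟨⟨χ ((0:ℝ) • a + (0:ℝ) • b), x⟩, y⟩ : TangentBundle I.tangent (TangentBundle I N))) hb h3

/-- The flip exchanges the order of the two differentiations of a map `ℝ² → N`. -/
theorem canonicalFlip_velocity (χ : ℝ × ℝ → N) (hχ : ContMDiff 𝓘(ℝ, ℝ × ℝ) I ∞ χ) :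
    canonicalFlip I (velocity I.tangent (fun s => velocity I (fun t => χ (s, t)) 0) 0) =
      velocity I.tangent (fun s => velocity I (fun t => χ (t, s)) 0) 0 := by
  have h1 := velocity_velocity I χ hχ (1,0) (0,1)
  have h2 := velocity_velocity I χ hχ (0,1) (1,0)
  have hg : ContDiffAt ℝ ∞ (fun x => extChartAt I (χ 0) (χ x)) 0 :=
    ((contMDiffAt_extChartAt (I := I) (n := ∞) (x := χ 0)).comp 0 hχ.contMDiffAt).contDiffAt
  have hsymm : IsSymmSndFDerivAt ℝ (fun x => extChartAt I (χ 0) (χ x)) 0 :=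
    ContDiffAt.isSymmSndFDerivAt (n := 2) (hg.of_le (by norm_cast)) (by simp)
  simp only [Prod.smul_mk, smul_eq_mul, mul_one, mul_zero, Prod.mk_add_mk, add_zero, zero_add] at h1 h2
  rw [h1, h2, hsymm.eq]
  exact congrArg (fun x => (⟨⟨χ x, fderiv ℝ (fun x => extChartAt I (χ 0) (χ x)) 0 (1, 0)⟩,
     ((fderiv ℝ (fun x => extChartAt I (χ 0) (χ x)) 0 (0, 1),
       fderiv ℝ (fderiv ℝ (fun x => extChartAt I (χ 0) (χ x))) 0 (0, 1) (1, 0)) : E × E)⟩ :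
      TangentBundle I.tangent (TangentBundle I N))) (by simp : ((0:ℝ) * 1 + (0:ℝ) * 0, (0:ℝ) * 0 + (0:ℝ) * 1) =
        ((0:ℝ) * 0 + (0:ℝ) * 1, (0:ℝ) * 1 + (0:ℝ) * 0))

theorem fderiv_aux {V W : Type*} [NormedAddCommGroup V] [NormedSpace ℝ V] [NormedAddCommGroup W] [NormedSpace ℝ W] (B : V →L[ℝ] W) (x : V) (f : V → W) (h : f =ᶠ[𝓝 x] B) : fderiv ℝ f x = B := by
  rw [h.fderiv_eq, B.fderiv]

set_option synthInstance.maxHeartbeats 200000 in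
set_option maxHeartbeats 1000000 in
/-- In the induced coordinates `(q, p)`, `ω = dq ∧ dp`. -/
theorem canonicalForm_apply [I.Boundaryless] (ε : CotangentBundle I N) (u v : TangentSpace (cotModel I) ε) :
    canonicalForm I ε u v =  (v : E × (E →L[ℝ] ℝ)).2 (u : E × (E →L[ℝ] ℝ)).1 - (u : E × (E →L[ℝ] ℝ)).2 (v : E × (E →L[ℝ] ℝ)).1 := by
  have key : ∀ y ∈ (extChartAt (cotModel I) ε).target,
    (ContinuousLinearMap.comp (M₂ := E × (E →L[ℝ] ℝ))  (liouvilleForm I ((extChartAt (cotModel I) ε).symm y)) (mfderiv 𝓘(ℝ, E × (E →L[ℝ] ℝ)) (cotModel I) (extChartAt (cotModel I) ε).symm y) : (E × (E →L[ℝ] ℝ)) →L[ℝ] ℝ) = y.2.comp (ContinuousLinearMap.fst ℝ E (E →L[ℝ] ℝ)) := by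
    intro y hy
    have d1 : MDifferentiableAt 𝓘(ℝ, E × (E →L[ℝ] ℝ)) (cotModel I) (extChartAt (cotModel I) ε).symm y := by
      have := mdifferentiableWithinAt_extChartAt_symm (I := cotModel I) hy
      rwa [ModelWithCorners.range_eq_univ, mdifferentiableWithinAt_univ] at this
    have d2 := (hasMFDerivAt_proj_cot I ((extChartAt (cotModel I) ε).symm y)).mdifferentiableAt
    have d3 := mfderiv_comp y d2 d1
    have hS : ∀ z ∈ (extChartAt (cotModel I) ε).target, ((extChartAt (cotModel I) ε).symm z).proj ∈ (chartAt H ε.proj).source := by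
      have : ∀ w ∈ (extChartAt (cotModel I) ε).source, w.proj ∈ (chartAt H ε.proj).source := by
        intro w hw
        rw [FiberBundle.extChartAt] at hw
        simp at hw
        exact hw.1
      exact fun z hz => this _ ((extChartAt (cotModel I) ε).map_target hz)
    have hE : ∀ z ∈ (extChartAt (cotModel I) ε).target, extChartAt I ε.proj ((extChartAt (cotModel I) ε).symm z).proj = z.1 := by
      intro z hz
      have hr := (extChartAt (cotModel I) ε).right_inv hz
      rw [extChartAt_cot] at hr
      exact congrArg Prod.fst hr
    have hr := (extChartAt (cotModel I) ε).right_inv hy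
    rw [extChartAt_cot] at hr
    have hy2 := congrArg Prod.snd hr
    have d4 : (TotalSpace.proj ∘ (extChartAt (cotModel I) ε).symm) =ᶠ[𝓝 y] (extChartAt I ε.proj).symm ∘ Prod.fst := by
      filter_upwards [extChartAt_target_mem_nhds' hy] with z hz
      simp only [Function.comp_apply]
      rw [← hE z hz]
      refine ((extChartAt I ε.proj).left_inv ?_).symm
      rw [extChartAt_source]
      exact hS z hz
    have d5 := TangentBundle.symmL_trivializationAt (I := I) (hS y hy)
    rw [hE y hy, ModelWithCorners.range_eq_univ, mfderivWithin_univ] at d5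
    have hyt : y.1 ∈ (extChartAt I ε.proj).target := by
      rw [← hE y hy]
      exact (extChartAt I ε.proj).map_source (by rw [extChartAt_source]; exact hS y hy)
    have d6 : MDifferentiableAt 𝓘(ℝ, E) I (extChartAt I ε.proj).symm y.1 := by
      have := mdifferentiableWithinAt_extChartAt_symm (I := I) hyt
      rwa [ModelWithCorners.range_eq_univ, mdifferentiableWithinAt_univ] at this
    have d7 : HasMFDerivAt 𝓘(ℝ, E × (E →L[ℝ] ℝ)) 𝓘(ℝ, E) (Prod.fst : E × (E →L[ℝ] ℝ) → E) y (ContinuousLinearMap.fst ℝ E (E →L[ℝ] ℝ)) :=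
      (hasFDerivAt_fst).hasMFDerivAt
    have d8 := mfderiv_comp y d6 d7.mdifferentiableAt
    rw [← d4.mfderiv_eq, d7.mfderiv] at d8
    have d9 := d3.symm.trans d8
    refine ContinuousLinearMap.ext fun w => ?_
    have e1 := congrArg (fun L => L w) d9
    have e2 := congrArg (fun L => ((extChartAt (cotModel I) ε).symm y).snd (L w.1)) d5
    have e3 := congrArg (fun L => L w.1) hy2
    refine Eq.trans ?_ e3
    refine Eq.trans ?_ e2.symm
    exact congrArg (fun x => ((extChartAt (cotModel I) ε).symm y).snd x) e1
  have hD : (mfderiv (cotModel I) 𝓘(ℝ, E × (E →L[ℝ] ℝ)) (extChartAt (cotModel I) ε) ε) = ContinuousLinearMap.id ℝ _ := mfderiv_extChartAt_self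
  let B : (E × (E →L[ℝ] ℝ)) →L[ℝ] ((E × (E →L[ℝ] ℝ)) →L[ℝ] ℝ) :=
    ((ContinuousLinearMap.compL ℝ (E × (E →L[ℝ] ℝ)) E ℝ).flip (ContinuousLinearMap.fst ℝ E (E →L[ℝ] ℝ))).comp (ContinuousLinearMap.snd ℝ E (E →L[ℝ] ℝ))
  have hder := fderiv_aux B (extChartAt (cotModel I) ε ε) (fun y => (ContinuousLinearMap.comp (M₂ := E × (E →L[ℝ] ℝ))  (liouvilleForm I ((extChartAt (cotModel I) ε).symm y)) (mfderiv 𝓘(ℝ, E × (E →L[ℝ] ℝ)) (cotModel I) (extChartAt (cotModel I) ε).symm y) : (E × (E →L[ℝ] ℝ)) →L[ℝ] ℝ)) (by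
    filter_upwards [extChartAt_target_mem_nhds (I := cotModel I) ε] with y hy using key y hy)
  have h1 : canonicalForm I ε u v = - (B u v - B v u) := by
    unfold canonicalForm extDerivOneForm
    simp only [hD]
    exact congrArg (fun L : (E × (E →L[ℝ] ℝ)) →L[ℝ] ((E × (E →L[ℝ] ℝ)) →L[ℝ] ℝ) => - (L u v - L v u)) hder
  rw [h1]
  exact neg_sub _ _

end Generic

/-- Almost-regularity of a Hamiltonian `h : T*M → ℝ`, where `C` is a submanifold of `TM` with
inclusion `ι : C → TM` (an injective immersion) and `Fh : T*M → C` is the fibre derivative of `h`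
with codomain restricted to `C`. -/
structure IsAlmostRegular {E H M F G C : Type*} [NormedAddCommGroup E] [NormedSpace ℝ E]
    [TopologicalSpace H] (I : ModelWithCorners ℝ E H)
    [TopologicalSpace M] [ChartedSpace H M] [IsManifold I ∞ M]
    [NormedAddCommGroup F] [NormedSpace ℝ F] [TopologicalSpace G] (J : ModelWithCorners ℝ F G)
    [TopologicalSpace C] [ChartedSpace G C]
    (h : CotangentBundle I M → ℝ) (ι : C → TangentBundle I M) (Fh : CotangentBundle I M → C) :
    Prop where
  injective : Function.Injective ι
  immersion : IsImmersion J I.tangent ∞ ι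
  fiberDeriv_eq : ∀ ε, ι (Fh ε) = fiberDeriv I h ε
  surjective : Function.Surjective Fh
  submersion : IsSubmersion (cotModel I) J ∞ Fh
  connected_fibers : ∀ c, IsConnected (Fh ⁻¹' {c})

end Tulczyjew

end

open Tulczyjew

/-! In induced coordinates the Hamiltonian field is X = (h_p, -h_q), so α ∘ X is the map (q, p) ↦
(q, h_p, -h_q, p). Everything rests on this formula, on the symmetry of the second derivative of h,
and on the shape of the fibres of the fibre derivative.

Lagrangian property. The image of α ∘ X is a graph over the coordinates (q, p), isotropic because
D²h is symmetric. A shear straightens it to a linear slice of half dimension. This part,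
`isLagrangianSubmanifold_alpha_image`, needs no regularity of h; it rests on the local formula
`cotChart_alpha`.

Descent of L. In d(p·h_p - h) the terms in dp cancel, leaving p·d(h_p) - h_q dq. This vanishes on
the kernel of the differential of `Fh`, which consists of the vertical vectors killed by the fibre
Hessian h_pp. Since fibres are connected, Δ^*h - h is constant on each of them
(`dilationDefect_eq_of_eq`), and local sections of the submersion make L smooth.

Image contained in Σ_L. The same formula gives dL on vectors coming from T*M, and it agrees with
α(X(ε)) on their images in T(TM); the differential of `Fh` is onto, so no other vectors need
testing.

Σ_L contained in the image. Let μ ∈ Σ_L lie over Fh(ε₀), with ε₀ = (q, p₀), and let b be its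
component dual to v̇. Testing μ on vertical vectors and using the symmetry of h_pp gives h_pp(ε₀)(b
- p₀) = 0. The point is that (q, b) then lies in the fibre of ε₀. The kernel of h_pp is the
annihilator of the image of h_pp, and this image is the vertical part of the tangent space of C, so
the kernel depends only on the point of C. Hence the fibre is locally open in an affine translate of
the kernel (`fiber_open`); being also closed, it contains the whole translate (`fiber_translate`).
At the representative (q, b), the condition defining Σ_L forces the remaining component of μ to be
-h_q. -/

noncomputable section

/-! ### Submersions and immersions: differentials, local sections, functions constant along fibres.
-/

section Submersion

variable {E H M E' H' N : Type*} [NormedAddCommGroup E] [NormedSpace ℝ E] [TopologicalSpace H]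
  {I : ModelWithCorners ℝ E H} [TopologicalSpace M] [ChartedSpace H M]
  [NormedAddCommGroup E'] [NormedSpace ℝ E'] [TopologicalSpace H']
  {J : ModelWithCorners ℝ E' H'} [TopologicalSpace N] [ChartedSpace H' N] {n : ℕ∞ω}

theorem extend_symm_contMDiffAt [I.Boundaryless] {e : OpenPartialHomeomorph M H}
    (he : e ∈ IsManifold.maximalAtlas I n M) {z : E} (hz : z ∈ (e.extend I).target) :
    ContMDiffAt 𝓘(ℝ, E) I n (e.extend I).symm z := by
  have h1 := contMDiffOn_extend_symm he
  have h2 : I '' e.target = (e.extend I).target := by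
    rw [e.extend_target, I.image_eq]
  rw [h2] at h1
  exact h1.contMDiffAt ((e.isOpen_extend_target (I := I)).mem_nhds hz)

/-- The differential of a chart of the maximal atlas is injective. -/
theorem mfderiv_extend_injective [I.Boundaryless] {e : OpenPartialHomeomorph M H}
    (he : e ∈ IsManifold.maximalAtlas I n M) (hn : n ≠ 0) {x : M} (hx : x ∈ e.source) :
    Function.Injective (mfderiv I 𝓘(ℝ, E) (e.extend I) x) := by
  have hx' : x ∈ (e.extend I).source := by rwa [e.extend_source]
  have h1 := (extend_symm_contMDiffAt he ((e.extend I).map_source hx')).mdifferentiableAt hn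
  have h2 := (e.contMDiffAt_extend he hx).mdifferentiableAt hn
  have h3 : HasMFDerivAt I I ((e.extend I).symm ∘ e.extend I) x (ContinuousLinearMap.id ℝ _) := by
    refine (hasMFDerivAt_id x).congr_of_eventuallyEq ?_
    filter_upwards [e.open_source.mem_nhds hx] with y hy
    exact (e.extend I).left_inv (by rwa [e.extend_source])
  have h4 := (h1.hasMFDerivAt.comp x h2.hasMFDerivAt)
  have h5 := hasMFDerivAt_unique h3 h4
  intro u v huv
  have h6 := congrArg (fun T => T u) h5
  have h7 := congrArg (fun T => T v) h5
  refine h6.trans (Eq.trans ?_ h7.symm)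
  exact congrArg (mfderiv 𝓘(ℝ, E) I (e.extend I).symm (e.extend I x)) huv

/-- The differential of an immersion is injective. -/
theorem Manifold.IsImmersionAt.mfderiv_injective [I.Boundaryless] [J.Boundaryless]
    {f : M → N} {x : M} (hf : IsImmersionAt I J n f x) (hn : n ≠ 0) :
    Function.Injective (mfderiv I J f x) := by
  have hx := hf.mem_domChart_source
  have h1 := (hf.domChart.contMDiffAt_extend hf.domChart_mem_maximalAtlas hx).mdifferentiableAt hn
  have h2 := (hf.codChart.contMDiffAt_extend hf.codChart_mem_maximalAtlas
    hf.mem_codChart_source).mdifferentiableAt hn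
  have h3 := hf.contMDiffAt.mdifferentiableAt hn
  -- In adapted charts the immersion is the linear injection `A`, that is u ↦ (u, 0) followed by an
  -- isomorphism, so injectivity reduces to that of `A` and of the domain chart.
  let A : E →L[ℝ] E' := (hf.equiv : _ →L[ℝ] E').comp (ContinuousLinearMap.inl ℝ E hf.complement)
  have hA : HasMFDerivAt I 𝓘(ℝ, E') (hf.codChart.extend J ∘ f) x
      ((A : E →L[ℝ] E').comp (mfderiv I 𝓘(ℝ, E) (hf.domChart.extend I) x)) := by
    have : HasMFDerivAt 𝓘(ℝ, E) 𝓘(ℝ, E') A (hf.domChart.extend I x) A :=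
      A.hasFDerivAt.hasMFDerivAt
    refine (this.comp x h1.hasMFDerivAt).congr_of_eventuallyEq ?_
    filter_upwards [hf.domChart.open_source.mem_nhds hx] with y hy
    have hy' : y ∈ (hf.domChart.extend I).source := by rwa [OpenPartialHomeomorph.extend_source]
    have := hf.writtenInCharts ((hf.domChart.extend I).map_source hy')
    simp only [Function.comp_apply, (hf.domChart.extend I).left_inv hy'] at this
    simpa [A] using this
  have h5 := hasMFDerivAt_unique hA (h2.hasMFDerivAt.comp x h3.hasMFDerivAt)
  intro u v huv
  have h6 := congrArg (fun T => T u) h5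
  have h7 := congrArg (fun T => T v) h5
  have h8 : A (mfderiv I 𝓘(ℝ, E) (hf.domChart.extend I) x u) =
      A (mfderiv I 𝓘(ℝ, E) (hf.domChart.extend I) x v) := by
    refine h6.trans (Eq.trans ?_ h7.symm)
    exact congrArg (mfderiv J 𝓘(ℝ, E') (hf.codChart.extend J) (f x)) huv
  have hAi : Function.Injective A := fun a b hab => by
    have := hf.equiv.injective hab
    simpa using this
  exact mfderiv_extend_injective hf.domChart_mem_maximalAtlas hn hx (hAi h8)

theorem Manifold.IsSubmersionAt.codChart_apply {f : M → N} {x : M} (hf : IsSubmersionAt I J n f x)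
    {y : M} (hy : y ∈ hf.domChart.source) :
    hf.codChart.extend J (f y) = (hf.equiv (hf.domChart.extend I y)).1 := by
  have hy' : y ∈ (hf.domChart.extend I).source := by rwa [OpenPartialHomeomorph.extend_source]
  have := hf.writtenInCharts ((hf.domChart.extend I).map_source hy')
  rwa [Function.comp_apply, Function.comp_apply, (hf.domChart.extend I).left_inv hy'] at this

/-- A submersion has a local section through every point. -/
theorem Manifold.IsSubmersionAt.exists_section [I.Boundaryless] [J.Boundaryless]
    {f : M → N} {x : M} (hf : IsSubmersionAt I J n f x) :
    ∃ s : N → M, ContMDiffAt J I n s (f x) ∧ s (f x) = x ∧ ∀ᶠ y in 𝓝 (f x), f (s y) = y := by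
  have hx : x ∈ (hf.domChart.extend I).source := by
    rw [OpenPartialHomeomorph.extend_source]; exact hf.mem_domChart_source
  have hz := (hf.domChart.extend I).map_source hx
  -- The section freezes the complementary coordinate at its value at `x` and lets only the base
  -- coordinate vary.
  let φ : E' → E := fun y => hf.equiv.symm (y, (hf.equiv (hf.domChart.extend I x)).2)
  have hφ : ContDiff ℝ n φ := hf.equiv.symm.contDiff.comp (contDiff_id.prodMk contDiff_const)
  have hw : hf.codChart.extend J (f x) = (hf.equiv (hf.domChart.extend I x)).1 :=
    hf.codChart_apply hf.mem_domChart_source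
  have hφx : φ (hf.codChart.extend J (f x)) = hf.domChart.extend I x := by
    simp only [φ, hw, hf.equiv.symm_apply_apply]
  have hg := hf.codChart.contMDiffAt_extend hf.codChart_mem_maximalAtlas hf.mem_codChart_source
  have hφg : ContMDiffAt J 𝓘(ℝ, E) n (fun y => φ (hf.codChart.extend J y)) (f x) :=
    hφ.contMDiff.contMDiffAt.comp (f x) hg
  refine ⟨fun y => (hf.domChart.extend I).symm (φ (hf.codChart.extend J y)), ?_, ?_, ?_⟩
  · refine ContMDiffAt.comp (f x) (I' := 𝓘(ℝ, E)) ?_ hφg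
    rw [hφx]
    exact extend_symm_contMDiffAt hf.domChart_mem_maximalAtlas hz
  · change (hf.domChart.extend I).symm (φ (hf.codChart.extend J (f x))) = x
    rw [hφx, (hf.domChart.extend I).left_inv hx]
  · have h1 : ∀ᶠ y in 𝓝 (f x), φ (hf.codChart.extend J y) ∈ (hf.domChart.extend I).target := by
      refine hφg.continuousAt ?_
      exact (hf.domChart.isOpen_extend_target (I := I)).mem_nhds (by rwa [hφx])
    filter_upwards [h1, hf.codChart.open_source.mem_nhds hf.mem_codChart_source] with y hy hys
    have h2 := hf.writtenInCharts hy
    simp only [Function.comp_apply] at h2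
    have h3 := (hf.domChart.extend I).map_target hy
    rw [OpenPartialHomeomorph.extend_source] at h3
    have h4 := hf.source_subset_preimage_source h3
    refine (hf.codChart.extend J).injOn ?_ ?_ ?_
    · rwa [OpenPartialHomeomorph.extend_source]
    · rwa [OpenPartialHomeomorph.extend_source]
    · rw [h2]; simp [φ]

/-- Differentiating `f ∘ s = id` for a local section `s` through the point exhibits a right inverse
of the differential. -/
theorem Manifold.IsSubmersionAt.mfderiv_surjective [I.Boundaryless] [J.Boundaryless]
    {f : M → N} {x : M} (hf : IsSubmersionAt I J n f x) (hn : n ≠ 0) :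
    Function.Surjective (mfderiv I J f x) := by
  obtain ⟨s, hs, hsx, hfs⟩ := hf.exists_section
  have h1 : MDifferentiableAt I J f (s (f x)) := by
    rw [hsx]; exact hf.contMDiffAt.mdifferentiableAt hn
  have h2 := h1.hasMFDerivAt.comp (f x) (hs.mdifferentiableAt hn).hasMFDerivAt
  have h3 : HasMFDerivAt J J (f ∘ s) (f x) (ContinuousLinearMap.id ℝ _) :=
    (hasMFDerivAt_id (f x)).congr_of_eventuallyEq (by filter_upwards [hfs] with y hy using hy)
  have h4 := hasMFDerivAt_unique h2 h3
  intro u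
  refine ⟨mfderiv J I s (f x) u, ?_⟩
  have h5 := congrArg (fun T => T u) h4
  have : mfderiv I J f (s (f x)) (mfderiv J I s (f x) u) = u := h5
  rwa [hsx] at this

/-- A function whose differential vanishes along the fibre of a submersion is locally constant on
this fibre. -/
theorem Manifold.IsSubmersionAt.eventually_eq_of_mfderiv_eq_zero [I.Boundaryless] [J.Boundaryless]
    {V : Type*} [NormedAddCommGroup V] [NormedSpace ℝ V]
    {f : M → N} {x : M} (hf : IsSubmersionAt I J n f x) (hn : n ≠ 0) {g : M → V}
    (hg : ∀ᶠ y in 𝓝 x, f y = f x → MDifferentiableAt I 𝓘(ℝ, V) g y ∧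
      ∀ u : TangentSpace I y, mfderiv I J f y u = 0 → mfderiv I 𝓘(ℝ, V) g y u = 0) :
    ∀ᶠ y in 𝓝 x, f y = f x → g y = g x := by
  have hx : x ∈ (hf.domChart.extend I).source := by
    rw [OpenPartialHomeomorph.extend_source]; exact hf.mem_domChart_source
  have hz := (hf.domChart.extend I).map_source hx
  have hgood : ∀ᶠ z in 𝓝 (hf.domChart.extend I x), z ∈ (hf.domChart.extend I).target ∧
      (f ((hf.domChart.extend I).symm z) = f x →
        MDifferentiableAt I 𝓘(ℝ, V) g ((hf.domChart.extend I).symm z) ∧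
        ∀ u : TangentSpace I ((hf.domChart.extend I).symm z),
          mfderiv I J f _ u = 0 → mfderiv I 𝓘(ℝ, V) g _ u = 0) := by
    refine Filter.Eventually.and
      ((hf.domChart.isOpen_extend_target (I := I)).mem_nhds hz) ?_
    have hc := (extend_symm_contMDiffAt hf.domChart_mem_maximalAtlas hz).continuousAt
    rw [ContinuousAt, (hf.domChart.extend I).left_inv hx] at hc
    exact hc.eventually hg
  have hgood' : ∀ᶠ p in 𝓝 (hf.equiv (hf.domChart.extend I x)),
      hf.equiv.symm p ∈ (hf.domChart.extend I).target ∧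
      (f ((hf.domChart.extend I).symm (hf.equiv.symm p)) = f x →
        MDifferentiableAt I 𝓘(ℝ, V) g ((hf.domChart.extend I).symm (hf.equiv.symm p)) ∧
        ∀ u : TangentSpace I ((hf.domChart.extend I).symm (hf.equiv.symm p)),
          mfderiv I J f _ u = 0 → mfderiv I 𝓘(ℝ, V) g _ u = 0) := by
    have hc : Filter.Tendsto hf.equiv.symm (𝓝 (hf.equiv (hf.domChart.extend I x)))
        (𝓝 (hf.domChart.extend I x)) := by
      have := hf.equiv.symm.continuous.continuousAt (x := hf.equiv (hf.domChart.extend I x))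
      rwa [ContinuousAt, hf.equiv.symm_apply_apply] at this
    exact hc.eventually hgood
  obtain ⟨r, hr, hball⟩ := Metric.eventually_nhds_iff_ball.1 hgood'
  set a := hf.equiv (hf.domChart.extend I x) with ha
  have hw : ∀ y ∈ hf.domChart.source,
      hf.codChart.extend J (f y) = (hf.equiv (hf.domChart.extend I y)).1 :=
    fun _ hy => hf.codChart_apply hy
  -- `σ` parametrizes the fibre through `x` near `x`: the base coordinate is fixed at its value
  -- there.
  let σ : hf.complement → M := fun w => (hf.domChart.extend I).symm (hf.equiv.symm (a.1, w))
  have hmem : ∀ w ∈ Metric.ball a.2 r, (a.1, w) ∈ Metric.ball a r := by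
    intro w hw
    simp only [Metric.mem_ball, Prod.dist_eq, dist_self] at hw ⊢
    exact max_lt hr hw
  have hσf : ∀ w ∈ Metric.ball a.2 r, f (σ w) = f x := by
    intro w hwr
    obtain ⟨h1, -⟩ := hball _ (hmem w hwr)
    have h3 := (hf.domChart.extend I).map_target h1
    rw [OpenPartialHomeomorph.extend_source] at h3
    refine (hf.codChart.extend J).injOn ?_ ?_ ?_
    · rw [OpenPartialHomeomorph.extend_source]; exact hf.source_subset_preimage_source h3
    · rw [OpenPartialHomeomorph.extend_source]; exact hf.mem_codChart_source
    · rw [hw _ h3, hw x hf.mem_domChart_source, (hf.domChart.extend I).right_inv h1]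
      simp [a]
  have hder : ∀ w ∈ Metric.ball a.2 r, HasFDerivAt (g ∘ σ) (0 : hf.complement →L[ℝ] V) w := by
    intro w hwr
    obtain ⟨h1, h2⟩ := hball _ (hmem w hwr)
    obtain ⟨h3, h4⟩ := h2 (hσf w hwr)
    have hσ : MDifferentiableAt 𝓘(ℝ, hf.complement) I σ w := by
      have e1 := (extend_symm_contMDiffAt hf.domChart_mem_maximalAtlas h1).mdifferentiableAt hn
      have e2 : MDifferentiableAt 𝓘(ℝ, hf.complement) 𝓘(ℝ, E)
          (fun w => hf.equiv.symm (a.1, w)) w := by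
        refine DifferentiableAt.mdifferentiableAt ?_
        exact hf.equiv.symm.differentiable.differentiableAt.comp w
          ((differentiableAt_const _).prodMk differentiableAt_id)
      exact e1.comp w e2
    have hfd : MDifferentiableAt I J f (σ w) := by
      have h5 := (hf.domChart.extend I).map_target h1
      rw [OpenPartialHomeomorph.extend_source] at h5
      exact (hf.contMDiffOn.contMDiffAt (hf.domChart.open_source.mem_nhds h5)).mdifferentiableAt hn
    have e3 := hfd.hasMFDerivAt.comp w hσ.hasMFDerivAt
    have e4 : HasMFDerivAt 𝓘(ℝ, hf.complement) J (f ∘ σ) w 0 := by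
      refine (hasMFDerivAt_const (f x) w).congr_of_eventuallyEq ?_
      filter_upwards [Metric.isOpen_ball.mem_nhds hwr] with w' hw' using hσf w' hw'
    have e5 := hasMFDerivAt_unique e3 e4
    have e6 := h3.hasMFDerivAt.comp w hσ.hasMFDerivAt
    -- `f ∘ σ` is constant, so velocities of `σ` lie in the kernel of the differential of `f`, where
    -- that of `g` vanishes by assumption.
    have e7 : (mfderiv I 𝓘(ℝ, V) g (σ w)).comp (mfderiv 𝓘(ℝ, hf.complement) I σ w) = 0 := by
      ext u
      exact h4 _ (congrArg (fun T => T u) e5)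
    have e8 := e6.hasFDerivAt
    exact e8.congr_fderiv e7
  have hconst : ∀ w ∈ Metric.ball a.2 r, g (σ w) = g (σ a.2) := by
    intro w hwr
    exact (convex_ball a.2 r).is_const_of_fderivWithin_eq_zero
      (f := g ∘ σ) (𝕜 := ℝ) (fun w hw => (hder w hw).differentiableAt.differentiableWithinAt)
      (fun w hw => by
        rw [fderivWithin_of_isOpen Metric.isOpen_ball hw]; exact (hder w hw).fderiv)
      hwr (Metric.mem_ball_self hr)
  have hc : ContinuousAt (fun y => hf.equiv (hf.domChart.extend I y)) x :=
    hf.equiv.continuous.continuousAt.comp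
      (hf.domChart.contMDiffAt_extend hf.domChart_mem_maximalAtlas
        hf.mem_domChart_source).continuousAt
  have hev : ∀ᶠ y in 𝓝 x, hf.equiv (hf.domChart.extend I y) ∈ Metric.ball a r :=
    hc (Metric.ball_mem_nhds _ hr)
  filter_upwards [hev, hf.domChart.open_source.mem_nhds hf.mem_domChart_source] with y hy hys hfy
  -- Each point of the fibre in the chart domain is recovered by `σ` from its complementary
  -- coordinate, so constancy of `g ∘ σ` on a ball gives the claim.
  have hyw : ∀ y ∈ hf.domChart.source, f y = f x →
      σ (hf.equiv (hf.domChart.extend I y)).2 = y := by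
    intro y hys hfy
    have h1 : (a.1, (hf.equiv (hf.domChart.extend I y)).2) = hf.equiv (hf.domChart.extend I y) := by
      refine Prod.ext ?_ rfl
      rw [← hw y hys, hfy, hw x hf.mem_domChart_source]
    simp only [σ, h1, hf.equiv.symm_apply_apply]
    exact (hf.domChart.extend I).left_inv (by rwa [OpenPartialHomeomorph.extend_source])
  have h2 := hconst (hf.equiv (hf.domChart.extend I y)).2 (by
    simp only [Metric.mem_ball, Prod.dist_eq] at hy ⊢
    exact lt_of_le_of_lt (le_max_right _ _) hy)
  rw [hyw y hys hfy, hyw x hf.mem_domChart_source rfl] at h2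
  exact h2

/-- A function that is locally constant along a connected fibre is constant on it. -/
theorem IsPreconnected.eq_of_eventually_eq {X Y : Type*} [TopologicalSpace X] {s : Set X}
    (hs : IsPreconnected s) {g : X → Y} (hg : ∀ x ∈ s, ∀ᶠ y in 𝓝 x, y ∈ s → g y = g x)
    {x y : X} (hx : x ∈ s) (hy : y ∈ s) : g x = g y := by
  have := isPreconnected_iff_preconnectedSpace.1 hs
  have hl : IsLocallyConstant (fun z : s => g z) := by
    rw [IsLocallyConstant.iff_eventually_eq]
    intro z
    have := (continuous_subtype_val.continuousAt (x := z)).eventually (hg z z.2)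
    filter_upwards [this] with w hw using hw w.2
  exact hl.apply_eq_of_preconnectedSpace ⟨x, hx⟩ ⟨y, hy⟩

/-- A function is smooth if its composition with a surjective submersion is smooth. -/
theorem Manifold.IsSubmersion.contMDiff_of_comp [I.Boundaryless] [J.Boundaryless]
    {E'' H'' Q : Type*} [NormedAddCommGroup E''] [NormedSpace ℝ E''] [TopologicalSpace H'']
    {I'' : ModelWithCorners ℝ E'' H''} [TopologicalSpace Q] [ChartedSpace H'' Q]
    {f : M → N} (hf : IsSubmersion I J n f) (hsurj : Function.Surjective f) {g : N → Q}
    (hg : ContMDiff I I'' n (g ∘ f)) : ContMDiff J I'' n g := by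
  intro c
  obtain ⟨x, rfl⟩ := hsurj c
  obtain ⟨s, hs, hsx, hfs⟩ := (hf.isSubmersionAt x).exists_section
  have h1 : ContMDiffAt J I'' n ((g ∘ f) ∘ s) (f x) := hg.contMDiffAt.comp (f x) hs
  refine h1.congr_of_eventuallyEq ?_
  filter_upwards [hfs] with y hy
  simp [hy]

end Submersion

/-! ### Reflexivity of finite-dimensional spaces. -/

section Bidual

variable {E : Type*} [NormedAddCommGroup E] [NormedSpace ℝ E] [FiniteDimensional ℝ E]

/-- In dual bases the inverse is ℓ ↦ ∑ ℓ(cᵢ) bᵢ. Having it as a continuous linear map lets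
smoothness of the fibre differential of h pass to the velocity h_p. -/
theorem exists_bidual_inverse (E : Type*) [NormedAddCommGroup E] [NormedSpace ℝ E]
    [FiniteDimensional ℝ E] :
    ∃ R : ((E →L[ℝ] ℝ) →L[ℝ] ℝ) →L[ℝ] E,
      ∀ (ℓ : (E →L[ℝ] ℝ) →L[ℝ] ℝ) (β : E →L[ℝ] ℝ), β (R ℓ) = ℓ β := by
  let b := Module.finBasis ℝ E
  let c : Fin (Module.finrank ℝ E) → E →L[ℝ] ℝ := fun i => LinearMap.toContinuousLinearMap (b.coord i)
  refine ⟨∑ i, (ContinuousLinearMap.apply ℝ ℝ (c i)).smulRight (b i), fun ℓ β => ?_⟩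
  have hβ : β = ∑ i, β (b i) • c i := by
    refine ContinuousLinearMap.ext fun w => ?_
    conv_lhs => rw [← b.sum_repr w, map_sum]
    simp [c, mul_comm]
  conv_rhs => rw [hβ, map_sum]
  simp [mul_comm]

/-- The inverse of the evaluation map of a finite-dimensional space into its bidual. -/
def bidualInv : ((E →L[ℝ] ℝ) →L[ℝ] ℝ) →L[ℝ] E := (exists_bidual_inverse E).choose

theorem apply_bidualInv (ℓ : (E →L[ℝ] ℝ) →L[ℝ] ℝ) (β : E →L[ℝ] ℝ) : β (bidualInv ℓ) = ℓ β :=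
  (exists_bidual_inverse E).choose_spec ℓ β

theorem eq_bidualInv {v : E} {ℓ : (E →L[ℝ] ℝ) →L[ℝ] ℝ} (h : ∀ β : E →L[ℝ] ℝ, β v = ℓ β) :
    v = bidualInv ℓ := by
  refine SeparatingDual.eq_iff_forall_dual_eq (R := ℝ) |>.2 fun β => ?_
  exact (h β).trans (apply_bidualInv ℓ β).symm

end Bidual

/-! ### Induced charts of the cotangent bundle and Hamilton's equations. -/

namespace Tulczyjew

variable {E : Type*} [NormedAddCommGroup E] [NormedSpace ℝ E]
  {H : Type*} [TopologicalSpace H]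
  (I : ModelWithCorners ℝ E H) {N : Type*} [TopologicalSpace N] [ChartedSpace H N]
  [IsManifold I ∞ N]

/-- The chart of `T*N` induced by the preferred chart of `N` at `q`. -/
def cotChart (q : N) : PartialEquiv (CotangentBundle I N) (E × (E →L[ℝ] ℝ)) :=
  extChartAt (cotModel I) (⟨q, 0⟩ : CotangentBundle I N)

theorem cotChart_apply (q : N) (ε : CotangentBundle I N) :
    cotChart I q ε = (extChartAt I q ε.proj, (ε.snd : E →L[ℝ] ℝ).comp
      ((trivializationAt E (TangentSpace I) q).symmL ℝ ε.proj : E →L[ℝ] E)) :=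
  extChartAt_cot I _ _

theorem mem_cotChart_source {q : N} {ε : CotangentBundle I N} :
    ε ∈ (cotChart I q).source ↔ ε.proj ∈ (chartAt H q).source := by
  rw [cotChart, FiberBundle.extChartAt]
  simp only [PartialEquiv.trans_source, PartialEquiv.prod_source, mem_inter_iff, mem_preimage,
    extChartAt_source, PartialEquiv.refl_source, mem_prod, mem_univ, and_true]
  have hb : (trivializationAt (E →L[ℝ] ℝ) (fun x : N => CotangentSpace I x) q).baseSet =
      (chartAt H q).source := by simp
  constructor
  · rintro ⟨h1, -⟩
    rw [← hb]
    exact (Trivialization.mem_source _).1 h1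
  · intro h1
    rw [← hb] at h1
    refine ⟨(Trivialization.mem_source _).2 h1, ?_⟩
    have := Trivialization.coe_fst' (trivializationAt (E →L[ℝ] ℝ) (fun x : N => CotangentSpace I x) q) h1
    rw [← hb]
    exact this.symm ▸ h1

theorem cotChart_target (q : N) :
    (cotChart I q).target = (extChartAt I q).target ×ˢ (univ : Set (E →L[ℝ] ℝ)) := by
  rw [cotChart, FiberBundle.extChartAt_target]
  congr 1
  refine inter_eq_left.2 fun x hx => ?_
  have := (extChartAt I q).map_target hx
  rw [extChartAt_source] at this
  simpa using this

variable {I} in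
/-- The momentum component of a covector in the preferred chart. -/
def mom (ε : CotangentBundle I N) : E →L[ℝ] ℝ := ε.snd

/-- The trivialization at a point is the identity on the fibre over that point, so the chart reads
off the stored covector unchanged. -/
theorem cotChart_self (ε : CotangentBundle I N) :
    cotChart I ε.proj ε = (extChartAt I ε.proj ε.proj, mom ε) := by
  rw [cotChart_apply]
  erw [symmL_self]
  rfl

theorem isOpen_cotChart_target [I.Boundaryless] (q : N) : IsOpen (cotChart I q).target :=
  isOpen_extChartAt_target (I := cotModel I) _

/-- The local expression of a function on `T*N`. -/
def localRep (h : CotangentBundle I N → ℝ) (q : N) : E × (E →L[ℝ] ℝ) → ℝ :=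
  h ∘ (cotChart I q).symm

variable {I}

theorem cotChart_symm_contMDiffAt [I.Boundaryless] {q : N} {z : E × (E →L[ℝ] ℝ)}
    (hz : z ∈ (cotChart I q).target) :
    ContMDiffAt 𝓘(ℝ, E × (E →L[ℝ] ℝ)) (cotModel I) ∞ (cotChart I q).symm z :=
  (contMDiffOn_extChartAt_symm (I := cotModel I) (⟨q, 0⟩ : CotangentBundle I N)).contMDiffAt
    ((isOpen_cotChart_target I q).mem_nhds hz)

theorem localRep_contDiffAt [I.Boundaryless] {h : CotangentBundle I N → ℝ}
    (hh : ContMDiff (cotModel I) 𝓘(ℝ, ℝ) ∞ h) {q : N} {z : E × (E →L[ℝ] ℝ)}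
    (hz : z ∈ (cotChart I q).target) : ContDiffAt ℝ ∞ (localRep I h q) z :=
  (hh.contMDiffAt.comp z (cotChart_symm_contMDiffAt hz)).contDiffAt

theorem localRep_apply {h : CotangentBundle I N → ℝ} {q : N} {ε : CotangentBundle I N}
    (hε : ε.proj ∈ (chartAt H q).source) : localRep I h q (cotChart I q ε) = h ε := by
  rw [localRep, Function.comp_apply, (cotChart I q).left_inv ((mem_cotChart_source I).2 hε)]

theorem hasMFDerivAt_of_localRep [I.Boundaryless] {h : CotangentBundle I N → ℝ}
    (hh : ContMDiff (cotModel I) 𝓘(ℝ, ℝ) ∞ h) (ε : CotangentBundle I N) :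
    HasMFDerivAt (cotModel I) 𝓘(ℝ, ℝ) h ε
      (fderiv ℝ (localRep I h ε.proj) (cotChart I ε.proj ε)) := by
  refine ⟨hh.continuous.continuousAt, ?_⟩
  have hz : cotChart I ε.proj ε ∈ (cotChart I ε.proj).target :=
    (cotChart I ε.proj).map_source ((mem_cotChart_source I).2 (mem_chart_source H _))
  have := ((localRep_contDiffAt hh hz).differentiableAt (by simp)).hasFDerivAt
  -- The preferred chart at `ε` depends only on its base point, so `h` written in that chart is
  -- `localRep` by unfolding.
  exact this.hasFDerivWithinAt

theorem symmL_continuousLinearMapAt_tangent {q x : N} (hx : x ∈ (chartAt H q).source)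
    (v : TangentSpace I x) :
    (trivializationAt E (TangentSpace I) q).symmL ℝ x
      (trivializationAt E (TangentSpace I) q (⟨x, v⟩ : TangentBundle I N)).2 = v := by
  have hb : x ∈ (trivializationAt E (TangentSpace I : N → Type _) q).baseSet := by simpa using hx
  have := (trivializationAt E (TangentSpace I : N → Type _) q).symmL_continuousLinearMapAt
    (R := ℝ) hb v
  rwa [Trivialization.continuousLinearMapAt_apply, Trivialization.linearMapAt_apply, if_pos hb]
    at this

theorem continuousLinearMapAt_eq_triv {q x : N} (hx : x ∈ (chartAt H q).source)
    (v : TangentSpace I x) :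
    (trivializationAt E (TangentSpace I) q).continuousLinearMapAt ℝ x v =
      (trivializationAt E (TangentSpace I) q (⟨x, v⟩ : TangentBundle I N)).2 := by
  have hb : x ∈ (trivializationAt E (TangentSpace I : N → Type _) q).baseSet := by simpa using hx
  rw [Trivialization.continuousLinearMapAt_apply, Trivialization.linearMapAt_apply, if_pos hb]

theorem continuousLinearMapAt_symmL_tangent {q x : N} (hx : x ∈ (chartAt H q).source) (w : E) :
    (trivializationAt E (TangentSpace I) q).continuousLinearMapAt ℝ x
      ((trivializationAt E (TangentSpace I) q).symmL ℝ x w) = w :=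
  (trivializationAt E (TangentSpace I : N → Type _) q).continuousLinearMapAt_symmL
    (R := ℝ) (by simpa using hx) w

variable [FiniteDimensional ℝ E]

/-- The velocity `∂h/∂p` in the chart at `q`. -/
def velPart (h : CotangentBundle I N → ℝ) (q : N) (z : E × (E →L[ℝ] ℝ)) : E :=
  bidualInv ((fderiv ℝ (localRep I h q) z).comp (ContinuousLinearMap.inr ℝ E (E →L[ℝ] ℝ)))

omit [FiniteDimensional ℝ E] in
/-- The derivative `∂h/∂q` in the chart at `q`. -/
def basePart (h : CotangentBundle I N → ℝ) (q : N) (z : E × (E →L[ℝ] ℝ)) : E →L[ℝ] ℝ :=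
  (fderiv ℝ (localRep I h q) z).comp (ContinuousLinearMap.inl ℝ E (E →L[ℝ] ℝ))

theorem apply_velPart (h : CotangentBundle I N → ℝ) (q : N) (z : E × (E →L[ℝ] ℝ))
    (β : E →L[ℝ] ℝ) : β (velPart h q z) = fderiv ℝ (localRep I h q) z (0, β) := by
  rw [velPart, apply_bidualInv]
  rfl

omit [FiniteDimensional ℝ E] in
theorem cotChart_mem_target {q : N} {ε : CotangentBundle I N}
    (hε : ε.proj ∈ (chartAt H q).source) : cotChart I q ε ∈ (cotChart I q).target :=
  (cotChart I q).map_source ((mem_cotChart_source I).2 hε)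

variable [I.Boundaryless] {h : CotangentBundle I N → ℝ}

/-- The fibre derivative in the chart at `q`. -/
theorem triv_fiberDeriv (hh : ContMDiff (cotModel I) 𝓘(ℝ, ℝ) ∞ h) {q : N}
    {ε : CotangentBundle I N} (hε : ε.proj ∈ (chartAt H q).source) :
    (trivializationAt E (TangentSpace I) q (fiberDeriv I h ε)).2 =
      velPart h q (cotChart I q ε) := by
  refine eq_bidualInv fun γ => ?_
  let T := trivializationAt E (TangentSpace I : N → Type _) q
  -- `β` is `γ` carried to the fibre over `ε.proj`, so that adding `t • β` moves the chart point
  -- along `(0, γ)`.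
  let β : CotangentSpace I ε.proj := ContinuousLinearMap.comp (M₂ := E) γ (T.continuousLinearMapAt ℝ ε.proj)
  have h1 := fiberDeriv_spec I hh ε β
  have h2 : β (fiberDeriv I h ε).snd = γ (T (fiberDeriv I h ε)).2 :=
    congrArg γ (continuousLinearMapAt_eq_triv hε _)
  rw [← h2, h1]
  have h3 : ∀ t : ℝ, h ⟨ε.proj, ε.snd + t • β⟩ =
      localRep I h q (cotChart I q ε + t • ((0, γ) : E × (E →L[ℝ] ℝ))) := by
    intro t
    rw [← localRep_apply (I := I) (h := h) (q := q) (ε := ⟨ε.proj, ε.snd + t • β⟩) hε]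
    congr 1
    rw [cotChart_apply, cotChart_apply]
    refine Prod.ext (by simp) ?_
    refine ContinuousLinearMap.ext fun w => ?_
    have h4 : β (T.symmL ℝ ε.proj w) = γ w :=
      congrArg γ (continuousLinearMapAt_symmL_tangent hε w)
    change ε.snd (T.symmL ℝ ε.proj w) + t • β (T.symmL ℝ ε.proj w) =
      ε.snd (T.symmL ℝ ε.proj w) + t • γ w
    rw [h4]
  simp only [h3]
  have h5 := ((localRep_contDiffAt hh (cotChart_mem_target hε)).differentiableAt (by simp)).hasFDerivAt
  exact (h5.hasLineDerivAt ((0, γ) : E × (E →L[ℝ] ℝ))).lineDeriv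

/-- In the chart a dilation fixes q and scales p by eᵗ, whose derivative at t = 0 is p; the chain
rule gives p·h_p. -/
theorem dilationDeriv_eq (hh : ContMDiff (cotModel I) 𝓘(ℝ, ℝ) ∞ h) {q : N}
    {ε : CotangentBundle I N} (hε : ε.proj ∈ (chartAt H q).source) :
    dilationDeriv I h ε = (cotChart I q ε).2 (velPart h q (cotChart I q ε)) := by
  rw [apply_velPart]
  have h3 : ∀ t : ℝ, h ⟨ε.proj, Real.exp t • ε.snd⟩ =
      localRep I h q ((cotChart I q ε).1, Real.exp t • (cotChart I q ε).2) := by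
    intro t
    rw [← localRep_apply (I := I) (h := h) (q := q) (ε := ⟨ε.proj, Real.exp t • ε.snd⟩) hε]
    congr 1
    rw [cotChart_apply, cotChart_apply]
    rfl
  rw [dilationDeriv]
  simp only [h3]
  have h5 := ((localRep_contDiffAt hh (cotChart_mem_target hε)).differentiableAt
    (by simp)).hasFDerivAt
  have h6 : HasDerivAt (fun t : ℝ => ((cotChart I q ε).1, Real.exp t • (cotChart I q ε).2))
      (0, (cotChart I q ε).2) 0 := by
    refine (hasDerivAt_const (0:ℝ) _).prodMk ?_
    simpa using (Real.hasDerivAt_exp 0).smul_const (cotChart I q ε).2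
  have h7 : HasFDerivAt (localRep I h q) (fderiv ℝ (localRep I h q) (cotChart I q ε))
      ((cotChart I q ε).1, Real.exp 0 • (cotChart I q ε).2) := by simpa using h5
  exact (h7.comp_hasDerivAt (0:ℝ) h6).deriv

theorem velPart_self (hh : ContMDiff (cotModel I) 𝓘(ℝ, ℝ) ∞ h) (ε : CotangentBundle I N) :
    velPart h ε.proj (cotChart I ε.proj ε) = (fiberDeriv I h ε).snd := by
  rw [← triv_fiberDeriv hh (mem_chart_source H _)]
  exact triv_self I ε.proj (fiberDeriv I h ε).snd

/-- Since ω = dq ∧ dp, testing on `(0, β)` and on `(e, 0)` yields the two halves of Hamilton's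
equations. Existence and uniqueness of the field both follow. -/
theorem isHamiltonianVectorField_iff (hh : ContMDiff (cotModel I) 𝓘(ℝ, ℝ) ∞ h)
    (X : ∀ ε : CotangentBundle I N, TangentSpace (cotModel I) ε) :
    IsHamiltonianVectorField I h X ↔ ∀ ε, X ε = ((velPart h ε.proj (cotChart I ε.proj ε),
      -basePart h ε.proj (cotChart I ε.proj ε)) : E × (E →L[ℝ] ℝ)) := by
  have hd : ∀ ε (v : E × (E →L[ℝ] ℝ)), differential (cotModel I) h ε v =
      v.2 (velPart h ε.proj (cotChart I ε.proj ε)) +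
        basePart h ε.proj (cotChart I ε.proj ε) v.1 := by
    intro ε v
    rw [apply_velPart, differential, (hasMFDerivAt_of_localRep hh ε).mfderiv]
    have : v = (0, v.2) + (v.1, 0) := by simp
    conv_lhs => rw [this]
    exact map_add (fderiv ℝ (localRep I h ε.proj) (cotChart I ε.proj ε)) _ _
  constructor
  · intro hX ε
    have h1 : ∀ v : E × (E →L[ℝ] ℝ), v.2 (X ε : E × (E →L[ℝ] ℝ)).1 -
        (X ε : E × (E →L[ℝ] ℝ)).2 v.1 = v.2 (velPart h ε.proj (cotChart I ε.proj ε)) +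
        basePart h ε.proj (cotChart I ε.proj ε) v.1 := fun v =>
      ((canonicalForm_apply I ε (X ε) v).symm.trans (hX ε v)).trans (hd ε v)
    refine Prod.ext ?_ ?_
    · refine SeparatingDual.eq_iff_forall_dual_eq (R := ℝ) |>.2 fun β => ?_
      simpa using h1 (0, β)
    · refine ContinuousLinearMap.ext fun e => ?_
      have := h1 (e, 0)
      simp only [zero_apply, zero_sub, zero_add] at this
      simp only [neg_apply]
      linarith
  · intro hX ε v
    rw [canonicalForm_apply, hX ε]
    refine Eq.trans ?_ (hd ε v).symm
    simp

end Tulczyjew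

/-! ### Derivatives of the fibre derivative and of Δ^*h - h. -/

namespace Tulczyjew

set_option synthInstance.maxHeartbeats 400000

variable {E : Type*} [NormedAddCommGroup E] [NormedSpace ℝ E] [FiniteDimensional ℝ E]
  {H : Type*} [TopologicalSpace H]
  {I : ModelWithCorners ℝ E H} [I.Boundaryless]
  {N : Type*} [TopologicalSpace N] [ChartedSpace H N]
  [IsManifold I ∞ N] {h : CotangentBundle I N → ℝ}

omit [FiniteDimensional ℝ E] [I.Boundaryless] in
theorem cotChart_symm_mem {q : N} {z : E × (E →L[ℝ] ℝ)} (hz : z ∈ (cotChart I q).target) :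
    ((cotChart I q).symm z).proj ∈ (chartAt H q).source :=
  (mem_cotChart_source I).1 ((cotChart I q).map_target hz)

omit [FiniteDimensional ℝ E] [I.Boundaryless] in
theorem extChartAt_cotChart_symm {q : N} {z : E × (E →L[ℝ] ℝ)} (hz : z ∈ (cotChart I q).target) :
    extChartAt I q ((cotChart I q).symm z).proj = z.1 := by
  have := (cotChart I q).right_inv hz
  rw [cotChart_apply] at this
  exact congrArg Prod.fst this

omit [FiniteDimensional ℝ E] [I.Boundaryless] in
theorem cotChart_contMDiffAt {q : N} {ε : CotangentBundle I N}
    (hε : ε.proj ∈ (chartAt H q).source) :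
    ContMDiffAt (cotModel I) 𝓘(ℝ, E × (E →L[ℝ] ℝ)) ∞ (cotChart I q) ε := by
  refine contMDiffAt_extChartAt' ?_
  rw [← extChartAt_source (cotModel I)]
  exact (mem_cotChart_source I).2 hε

omit [FiniteDimensional ℝ E] in
theorem fderiv_localRep_contDiffAt (hh : ContMDiff (cotModel I) 𝓘(ℝ, ℝ) ∞ h) {q : N}
    {z : E × (E →L[ℝ] ℝ)} (hz : z ∈ (cotChart I q).target) :
    ContDiffAt ℝ ∞ (fderiv ℝ (localRep I h q)) z :=
  (localRep_contDiffAt hh hz).fderiv_right (m := ∞) (by simp)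

/-- The continuous linear map that sends the differential of a function to its velocity part. -/
def velMap (E : Type*) [NormedAddCommGroup E] [NormedSpace ℝ E] [FiniteDimensional ℝ E] :
    ((E × (E →L[ℝ] ℝ)) →L[ℝ] ℝ) →L[ℝ] E :=
  bidualInv.comp ((ContinuousLinearMap.compL ℝ (E →L[ℝ] ℝ) (E × (E →L[ℝ] ℝ)) ℝ).flip
    (ContinuousLinearMap.inr ℝ E (E →L[ℝ] ℝ)))

theorem apply_velMap (ℓ : (E × (E →L[ℝ] ℝ)) →L[ℝ] ℝ) (β : E →L[ℝ] ℝ) :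
    β (velMap E ℓ) = ℓ (0, β) :=
  apply_bidualInv _ β

omit [I.Boundaryless] in
theorem velPart_eq (q : N) :
    velPart h q = velMap E ∘ fderiv ℝ (localRep I h q) := rfl

theorem velPart_contDiffAt (hh : ContMDiff (cotModel I) 𝓘(ℝ, ℝ) ∞ h) {q : N}
    {z : E × (E →L[ℝ] ℝ)} (hz : z ∈ (cotChart I q).target) :
    ContDiffAt ℝ ∞ (velPart h q) z := by
  rw [velPart_eq]
  exact (velMap E).contDiff.contDiffAt.comp z (fderiv_localRep_contDiffAt hh hz)

theorem apply_fderiv_velPart (hh : ContMDiff (cotModel I) 𝓘(ℝ, ℝ) ∞ h) {q : N}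
    {z : E × (E →L[ℝ] ℝ)} (hz : z ∈ (cotChart I q).target) (δ : E × (E →L[ℝ] ℝ))
    (β : E →L[ℝ] ℝ) :
    β (fderiv ℝ (velPart h q) z δ) = fderiv ℝ (fderiv ℝ (localRep I h q)) z δ (0, β) := by
  have h1 := ((fderiv_localRep_contDiffAt hh hz).differentiableAt (by simp)).hasFDerivAt
  have h2 : HasFDerivAt (velPart h q) ((velMap E).comp (fderiv ℝ (fderiv ℝ (localRep I h q)) z)) z := by
    rw [velPart_eq]
    exact (velMap E).hasFDerivAt.comp z h1
  rw [h2.fderiv]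
  exact apply_velMap _ _

omit [FiniteDimensional ℝ E] in
theorem fderiv_fderiv_localRep_symm (hh : ContMDiff (cotModel I) 𝓘(ℝ, ℝ) ∞ h) {q : N}
    {z : E × (E →L[ℝ] ℝ)} (hz : z ∈ (cotChart I q).target) (δ δ' : E × (E →L[ℝ] ℝ)) :
    fderiv ℝ (fderiv ℝ (localRep I h q)) z δ δ' = fderiv ℝ (fderiv ℝ (localRep I h q)) z δ' δ := by
  have : IsSymmSndFDerivAt ℝ (localRep I h q) z :=
    ContDiffAt.isSymmSndFDerivAt (n := 2) ((localRep_contDiffAt hh hz).of_le (by norm_cast)) (by simp)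
  exact this.eq δ δ'

/-- The vertical derivative of h_p is the fibre Hessian h_pp, a block of the symmetric D²h. This
symmetry identifies the kernel of h_pp with the annihilator of its image. -/
theorem fderiv_velPart_symm (hh : ContMDiff (cotModel I) 𝓘(ℝ, ℝ) ∞ h) {q : N}
    {z : E × (E →L[ℝ] ℝ)} (hz : z ∈ (cotChart I q).target) (β γ : E →L[ℝ] ℝ) :
    β (fderiv ℝ (velPart h q) z (0, γ)) = γ (fderiv ℝ (velPart h q) z (0, β)) := by
  rw [apply_fderiv_velPart hh hz, apply_fderiv_velPart hh hz, fderiv_fderiv_localRep_symm hh hz]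

theorem fiberDeriv_contMDiff (hh : ContMDiff (cotModel I) 𝓘(ℝ, ℝ) ∞ h) :
    ContMDiff (cotModel I) I.tangent ∞ (fiberDeriv I h) := by
  intro ε
  rw [contMDiffAt_totalSpace]
  refine ⟨contMDiffAt_proj _, ?_⟩
  have hε : ε.proj ∈ (chartAt H ε.proj).source := mem_chart_source H _
  have h1 := (velPart_contDiffAt hh (cotChart_mem_target hε)).contMDiffAt.comp ε
    (cotChart_contMDiffAt hε)
  refine h1.congr_of_eventuallyEq ?_
  have hc : ∀ᶠ ε' : CotangentBundle I N in 𝓝 ε, ε'.proj ∈ (chartAt H ε.proj).source :=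
    (FiberBundle.continuous_proj _ _).continuousAt.eventually
      ((chartAt H ε.proj).open_source.mem_nhds hε)
  filter_upwards [hc] with ε' hε'
  exact triv_fiberDeriv hh hε'

/-- The differential of the fibre derivative in induced coordinates. -/
theorem hasMFDerivAt_fiberDeriv (hh : ContMDiff (cotModel I) 𝓘(ℝ, ℝ) ∞ h)
    (ε : CotangentBundle I N) :
    HasMFDerivAt (cotModel I) I.tangent (fiberDeriv I h) ε
      ((ContinuousLinearMap.fst ℝ E (E →L[ℝ] ℝ)).prod
        (fderiv ℝ (velPart h ε.proj) (cotChart I ε.proj ε))) := by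
  refine ⟨(fiberDeriv_contMDiff hh).continuous.continuousAt, ?_⟩
  have hz : cotChart I ε.proj ε ∈ (cotChart I ε.proj).target :=
    cotChart_mem_target (mem_chart_source H _)
  have h1 : HasFDerivAt (fun z : E × (E →L[ℝ] ℝ) => (z.1, velPart h ε.proj z))
      ((ContinuousLinearMap.fst ℝ E (E →L[ℝ] ℝ)).prod
        (fderiv ℝ (velPart h ε.proj) (cotChart I ε.proj ε))) (cotChart I ε.proj ε) :=
    hasFDerivAt_fst.prodMk ((velPart_contDiffAt hh hz).differentiableAt (by simp)).hasFDerivAt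
  refine HasFDerivAt.hasFDerivWithinAt (h1.congr_of_eventuallyEq ?_)
  filter_upwards [(isOpen_cotChart_target I ε.proj).mem_nhds hz] with z hzt
  have h2 := triv_fiberDeriv hh (cotChart_symm_mem hzt)
  rw [(cotChart I ε.proj).right_inv hzt] at h2
  have h3 := extChartAt_tangent I (fiberDeriv I h ε) (fiberDeriv I h ((cotChart I ε.proj).symm z))
  refine Eq.trans h3 (Prod.ext ?_ h2)
  exact extChartAt_cotChart_symm hzt

/-- The function `Δ^*h - h`. -/
def dilationDefect (h : CotangentBundle I N → ℝ) (ε : CotangentBundle I N) : ℝ :=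
  dilationDeriv I h ε - h ε

theorem dilationDefect_eq (hh : ContMDiff (cotModel I) 𝓘(ℝ, ℝ) ∞ h) {q : N}
    {ε : CotangentBundle I N} (hε : ε.proj ∈ (chartAt H q).source) :
    dilationDefect h ε = (cotChart I q ε).2 (velPart h q (cotChart I q ε)) -
      localRep I h q (cotChart I q ε) := by
  rw [dilationDefect, dilationDeriv_eq hh hε, localRep_apply hε]

theorem dilationDefect_contMDiff (hh : ContMDiff (cotModel I) 𝓘(ℝ, ℝ) ∞ h) :
    ContMDiff (cotModel I) 𝓘(ℝ, ℝ) ∞ (dilationDefect h) := by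
  intro ε
  have hε : ε.proj ∈ (chartAt H ε.proj).source := mem_chart_source H _
  have hz := cotChart_mem_target (I := I) hε
  have h1 : ContDiffAt ℝ ∞ (fun z : E × (E →L[ℝ] ℝ) => z.2 (velPart h ε.proj z) -
      localRep I h ε.proj z) (cotChart I ε.proj ε) :=
    (contDiffAt_snd.clm_apply (velPart_contDiffAt hh hz)).sub (localRep_contDiffAt hh hz)
  refine (h1.contMDiffAt.comp ε (cotChart_contMDiffAt hε)).congr_of_eventuallyEq ?_
  have hc : ∀ᶠ ε' : CotangentBundle I N in 𝓝 ε, ε'.proj ∈ (chartAt H ε.proj).source :=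
    (FiberBundle.continuous_proj _ _).continuousAt.eventually
      ((chartAt H ε.proj).open_source.mem_nhds hε)
  filter_upwards [hc] with ε' hε'
  exact dilationDefect_eq hh hε'

/-- In d(p·h_p - h) = p·d(h_p) + h_p dp - h_q dq - h_p dp the two terms in dp cancel. What remains
involves δ only through δq and the variation of h_p, that is, through the differential of the fibre
derivative. -/
theorem mfderiv_dilationDefect (hh : ContMDiff (cotModel I) 𝓘(ℝ, ℝ) ∞ h)
    (ε : CotangentBundle I N) (δ : E × (E →L[ℝ] ℝ)) :
    mfderiv (cotModel I) 𝓘(ℝ, ℝ) (dilationDefect h) ε δ =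
      mom ε (fderiv ℝ (velPart h ε.proj) (cotChart I ε.proj ε) δ) -
        basePart h ε.proj (cotChart I ε.proj ε) δ.1 := by
  have hε : ε.proj ∈ (chartAt H ε.proj).source := mem_chart_source H _
  have hz := cotChart_mem_target (I := I) hε
  set z := cotChart I ε.proj ε with hzdef
  have h1 := ((velPart_contDiffAt hh hz).differentiableAt (by simp)).hasFDerivAt
  have h2 := ((localRep_contDiffAt hh hz).differentiableAt (by simp)).hasFDerivAt
  let D : (E × (E →L[ℝ] ℝ)) →L[ℝ] ℝ := z.2.comp (fderiv ℝ (velPart h ε.proj) z) +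
    (ContinuousLinearMap.snd ℝ E (E →L[ℝ] ℝ)).flip (velPart h ε.proj z) -
      fderiv ℝ (localRep I h ε.proj) z
  have h3 : HasFDerivAt (fun y : E × (E →L[ℝ] ℝ) => y.2 (velPart h ε.proj y) -
      localRep I h ε.proj y) D z := (hasFDerivAt_snd.clm_apply h1).sub h2
  have h4 : HasMFDerivAt (cotModel I) 𝓘(ℝ, ℝ) (dilationDefect h) ε D := by
    refine ⟨(dilationDefect_contMDiff hh).continuous.continuousAt,
      HasFDerivAt.hasFDerivWithinAt (h3.congr_of_eventuallyEq ?_)⟩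
    filter_upwards [(isOpen_cotChart_target I ε.proj).mem_nhds hz] with w hw
    have := dilationDefect_eq hh (cotChart_symm_mem hw)
    rw [(cotChart I ε.proj).right_inv hw] at this
    exact this
  rw [h4.mfderiv]
  have h5 : z.2 = mom ε := by rw [hzdef, cotChart_self]
  have h6 : fderiv ℝ (localRep I h ε.proj) z δ = basePart h ε.proj z δ.1 +
      δ.2 (velPart h ε.proj z) := by
    have : δ = (δ.1, 0) + (0, δ.2) := by simp
    conv_lhs => rw [this]
    rw [map_add, apply_velPart]
    rfl
  have h7 : z.2 (fderiv ℝ (velPart h ε.proj) z δ) + δ.2 (velPart h ε.proj z) -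
      fderiv ℝ (localRep I h ε.proj) z δ = z.2 (fderiv ℝ (velPart h ε.proj) z δ) -
        basePart h ε.proj z δ.1 := by
    rw [h6]; ring
  have h8 : D δ = z.2 (fderiv ℝ (velPart h ε.proj) z δ) + δ.2 (velPart h ε.proj z) -
      fderiv ℝ (localRep I h ε.proj) z δ := rfl
  rw [h5] at h8 h7
  exact h8.trans h7

end Tulczyjew

/-- A subspace of a finite-dimensional space is a retract with coordinates. -/
theorem Submodule.exists_coordinates {V : Type*} [NormedAddCommGroup V] [NormedSpace ℝ V]
    [FiniteDimensional ℝ V] (K : Submodule ℝ V) :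
    ∃ (m : ℕ) (κ : V →L[ℝ] (Fin m → ℝ)) (s : (Fin m → ℝ) →L[ℝ] V),
      (∀ w, s w ∈ K) ∧ (∀ v ∈ K, s (κ v) = v) ∧ ∀ w, κ (s w) = w := by
  obtain ⟨κ, hκ⟩ := Submodule.ClosedComplemented.of_finiteDimensional K
  let e : K ≃L[ℝ] (Fin (Module.finrank ℝ K) → ℝ) :=
    (Module.finBasis ℝ K).equivFun.toContinuousLinearEquiv
  refine ⟨_, (e : K →L[ℝ] _).comp κ, K.subtypeL.comp (e.symm : (Fin (Module.finrank ℝ K) → ℝ) →L[ℝ] K), fun w => ?_,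
    fun v hv => ?_, fun w => ?_⟩
  · exact (e.symm w).2
  · change ((e.symm (e (κ v)) : K) : V) = v
    rw [e.symm_apply_apply]
    exact congrArg Subtype.val (hκ ⟨v, hv⟩)
  · change e (κ (e.symm w : K)) = w
    rw [hκ, e.apply_symm_apply]

/-! ### Fibres of an almost-regular fibre derivative and the kernel of the fibre Hessian. -/

namespace Tulczyjew

set_option synthInstance.maxHeartbeats 400000

variable {E : Type*} [NormedAddCommGroup E] [NormedSpace ℝ E] [FiniteDimensional ℝ E]
  {H : Type*} [TopologicalSpace H]
  {I : ModelWithCorners ℝ E H} [I.Boundaryless]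
  {N : Type*} [TopologicalSpace N] [ChartedSpace H N]
  [IsManifold I ∞ N] {h : CotangentBundle I N → ℝ}
  {F : Type*} [NormedAddCommGroup F] [NormedSpace ℝ F]
  {G : Type*} [TopologicalSpace G] {J : ModelWithCorners ℝ F G} [J.Boundaryless]
  {C : Type*} [TopologicalSpace C] [ChartedSpace G C]
  {ι : C → TangentBundle I N} {Fh : CotangentBundle I N → C}

/-- The derivative of the velocity part in the induced coordinates. -/
def velDeriv (h : CotangentBundle I N → ℝ) (ε : CotangentBundle I N) :
    (E × (E →L[ℝ] ℝ)) →L[ℝ] E :=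
  fderiv ℝ (velPart h ε.proj) (cotChart I ε.proj ε)

omit [FiniteDimensional ℝ E] [I.Boundaryless] in
theorem cotChart_self_mem_target (ε : CotangentBundle I N) :
    cotChart I ε.proj ε ∈ (cotChart I ε.proj).target :=
  cotChart_mem_target (mem_chart_source H _)

theorem velDeriv_symm (hh : ContMDiff (cotModel I) 𝓘(ℝ, ℝ) ∞ h) (ε : CotangentBundle I N)
    (β γ : E →L[ℝ] ℝ) : β (velDeriv h ε (0, γ)) = γ (velDeriv h ε (0, β)) :=
  fderiv_velPart_symm hh (cotChart_self_mem_target ε) β γ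

/-- The differential of a submersion out of `T*N`, in induced coordinates. -/
def cotDeriv (J : ModelWithCorners ℝ F G) (Fh : CotangentBundle I N → C)
    (ε : CotangentBundle I N) : (E × (E →L[ℝ] ℝ)) →L[ℝ] F :=
  mfderiv (cotModel I) J Fh ε

/-- The differential of a map into `TN`, in induced coordinates. -/
def inclDeriv (J : ModelWithCorners ℝ F G) (ι : C → TangentBundle I N) (c : C) :
    F →L[ℝ] E × E :=
  mfderiv J I.tangent ι c

namespace IsAlmostRegular

omit [FiniteDimensional ℝ E] [I.Boundaryless] [J.Boundaryless] in
theorem proj_eq (hreg : IsAlmostRegular I J h ι Fh) (ε : CotangentBundle I N) :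
    (ι (Fh ε)).proj = ε.proj := by
  rw [hreg.fiberDeriv_eq]; rfl

omit [FiniteDimensional ℝ E] [I.Boundaryless] [J.Boundaryless] in
theorem proj_eq_of_eq (hreg : IsAlmostRegular I J h ι Fh) {ε ε' : CotangentBundle I N}
    (he : Fh ε' = Fh ε) : ε'.proj = ε.proj := by
  rw [← hreg.proj_eq, ← hreg.proj_eq, he]

omit [J.Boundaryless] in
-- Chain rule for `ι ∘ Fh = fiberDeriv I h`. This is how tangent vectors of C are translated into
-- coordinates.
theorem inclDeriv_cotDeriv (hreg : IsAlmostRegular I J h ι Fh)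
    (hh : ContMDiff (cotModel I) 𝓘(ℝ, ℝ) ∞ h) (ε : CotangentBundle I N)
    (δ : E × (E →L[ℝ] ℝ)) :
    inclDeriv J ι (Fh ε) (cotDeriv J Fh ε δ) = (δ.1, velDeriv h ε δ) := by
  have h1 := ((hreg.immersion.contMDiff (Fh ε)).mdifferentiableAt (by simp)).hasMFDerivAt
  have h2 := ((hreg.submersion.contMDiff ε).mdifferentiableAt (by simp)).hasMFDerivAt
  have h3 := h1.comp ε h2
  have h4 : ι ∘ Fh = fiberDeriv I h := funext hreg.fiberDeriv_eq
  rw [h4] at h3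
  have h5 := hasMFDerivAt_unique h3 (hasMFDerivAt_fiberDeriv hh ε)
  exact congrArg (fun T => T δ) h5

omit [FiniteDimensional ℝ E] in
theorem cotDeriv_surjective (hreg : IsAlmostRegular I J h ι Fh) (ε : CotangentBundle I N) :
    Function.Surjective (cotDeriv J Fh ε) :=
  (hreg.submersion.isSubmersionAt ε).mfderiv_surjective (by simp)

omit [FiniteDimensional ℝ E] in
theorem inclDeriv_injective (hreg : IsAlmostRegular I J h ι Fh) (c : C) :
    Function.Injective (inclDeriv J ι c) :=
  (hreg.immersion.isImmersionAt c).mfderiv_injective (by simp)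

/-- The inclusion has injective differential, so the kernel can be read off from the differential of
the fibre derivative in coordinates. -/
theorem cotDeriv_eq_zero_iff (hreg : IsAlmostRegular I J h ι Fh)
    (hh : ContMDiff (cotModel I) 𝓘(ℝ, ℝ) ∞ h) (ε : CotangentBundle I N)
    (δ : E × (E →L[ℝ] ℝ)) :
    cotDeriv J Fh ε δ = 0 ↔ δ.1 = 0 ∧ velDeriv h ε δ = 0 := by
  have h1 := hreg.inclDeriv_cotDeriv hh ε δ
  constructor
  · intro h0
    rw [h0, map_zero] at h1
    exact ⟨(congrArg Prod.fst h1).symm, (congrArg Prod.snd h1).symm⟩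
  · rintro ⟨h2, h3⟩
    refine hreg.inclDeriv_injective (Fh ε) ?_
    rw [h1, h2, h3, map_zero]
    rfl

/-- The kernel of the fibre Hessian is constant along the fibres. -/
theorem velDeriv_eq_zero_of_eq (hreg : IsAlmostRegular I J h ι Fh)
    (hh : ContMDiff (cotModel I) 𝓘(ℝ, ℝ) ∞ h) {ε ε' : CotangentBundle I N} (he : Fh ε' = Fh ε)
    {β : E →L[ℝ] ℝ} (hβ : velDeriv h ε (0, β) = 0) : velDeriv h ε' (0, β) = 0 := by
  refine SeparatingDual.eq_iff_forall_dual_eq (R := ℝ) |>.2 fun γ => ?_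
  rw [map_zero, velDeriv_symm hh]
  have h1 := hreg.inclDeriv_cotDeriv hh ε' (0, γ)
  -- Both differentials map onto the same tangent space of C, so the vector h_pp(ε')γ is also
  -- h_pp(ε)δ.2 for some vertical δ. By symmetry, β kills it when h_pp(ε)β = 0.
  obtain ⟨δ, hδ⟩ := hreg.cotDeriv_surjective ε (cotDeriv J Fh ε' (0, γ))
  have h2 := hreg.inclDeriv_cotDeriv hh ε δ
  rw [hδ, ← he, h1] at h2
  have h3 : (0 : E) = δ.1 := congrArg Prod.fst h2
  have h4 : velDeriv h ε' (0, γ) = velDeriv h ε δ := congrArg Prod.snd h2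
  have h5 : δ = (0, δ.2) := Prod.ext h3.symm rfl
  rw [h4, h5, velDeriv_symm hh, hβ, map_zero]

/-- `Δ^*h - h` is constant along the fibres. -/
theorem dilationDefect_eq_of_eq (hreg : IsAlmostRegular I J h ι Fh)
    (hh : ContMDiff (cotModel I) 𝓘(ℝ, ℝ) ∞ h) {ε ε' : CotangentBundle I N}
    (he : Fh ε' = Fh ε) : dilationDefect h ε' = dilationDefect h ε := by
  refine (hreg.connected_fibers (Fh ε)).isPreconnected.eq_of_eventually_eq (fun x hx => ?_) he rfl
  have hx' : Fh x = Fh ε := hx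
  have := (hreg.submersion.isSubmersionAt x).eventually_eq_of_mfderiv_eq_zero (by simp)
    (g := dilationDefect h) (Filter.Eventually.of_forall fun y _ =>
      ⟨(dilationDefect_contMDiff hh y).mdifferentiableAt (by simp), fun u hu => ?_⟩)
  · filter_upwards [this] with y hy hy'
    exact hy (Eq.trans hy' hx'.symm)
  · obtain ⟨h1, h2⟩ := (hreg.cotDeriv_eq_zero_iff hh y u).1 hu
    refine (mfderiv_dilationDefect hh y u).trans ?_
    have h3 : fderiv ℝ (velPart h y.proj) (cotChart I y.proj y) u = 0 := h2
    have h4 : (u : E × (E →L[ℝ] ℝ)).1 = 0 := h1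
    rw [h3, h4, map_zero, map_zero]
    exact sub_zero (0 : ℝ)

/-- Let K be the kernel of the Hessian at ε. Tangent vectors to the fibre are vertical with momentum
in K, also at other points of the fibre, so near ε the fibre lies in the affine space ε + K. Since
all of K is tangent to the fibre at ε, the coordinates κ on K take all nearby values on the fibre,
so it fills ε + K near ε. -/
theorem fiber_open (hreg : IsAlmostRegular I J h ι Fh) [FiniteDimensional ℝ F]
    [IsManifold J ∞ C]
    (hh : ContMDiff (cotModel I) 𝓘(ℝ, ℝ) ∞ h) (ε : CotangentBundle I N) :
    ∀ᶠ γ in 𝓝 (mom ε), velDeriv h ε (0, γ - mom ε) = 0 →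
      Fh ⟨ε.proj, γ⟩ = Fh ε := by
  let K : Submodule ℝ (E →L[ℝ] ℝ) :=
    ((velDeriv h ε).comp (ContinuousLinearMap.inr ℝ E (E →L[ℝ] ℝ))).ker
  have hK : ∀ β : E →L[ℝ] ℝ, β ∈ K ↔ velDeriv h ε (0, β) = 0 := fun β => Iff.rfl
  obtain ⟨m, κ, s, hsK, hκ, hκs⟩ := K.exists_coordinates
  -- `ρ` is the projection with kernel K: it records the momentum modulo K, while `κ` gives
  -- coordinates on K itself.
  let ρ : (E →L[ℝ] ℝ) →L[ℝ] (E →L[ℝ] ℝ) := ContinuousLinearMap.id ℝ _ - s.comp κ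
  have hρ : ∀ β, ρ β = β - s (κ β) := fun β => rfl
  have hρK : ∀ β ∈ K, ρ β = 0 := fun β hβ => by rw [hρ, hκ β hβ]; exact sub_self β
  let ρ' : (E × (E →L[ℝ] ℝ)) →L[ℝ] (E →L[ℝ] ℝ) := ρ.comp (ContinuousLinearMap.snd ℝ E (E →L[ℝ] ℝ))
  have hz := cotChart_self_mem_target ε
  have hself : (cotChart I ε.proj ε).2 = mom ε := by rw [cotChart_self]
  -- along the fibre, the momentum modulo `K` is locally constant
  have hloc : ∀ᶠ y in 𝓝 ε, Fh y = Fh ε →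
      ρ' (cotChart I ε.proj y) = ρ' (cotChart I ε.proj ε) := by
    refine (hreg.submersion.isSubmersionAt ε).eventually_eq_of_mfderiv_eq_zero (by simp)
      (g := fun y => ρ' (cotChart I ε.proj y)) (Filter.Eventually.of_forall fun y hy => ?_)
    have hyp := hreg.proj_eq_of_eq hy
    have h1 : MDifferentiableAt (cotModel I) 𝓘(ℝ, E × (E →L[ℝ] ℝ)) (cotChart I ε.proj) y :=
      (cotChart_contMDiffAt (by rw [hyp]; exact mem_chart_source H _)).mdifferentiableAt (by simp)
    have h2 : mfderiv (cotModel I) 𝓘(ℝ, E × (E →L[ℝ] ℝ)) (cotChart I ε.proj) y =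
        ContinuousLinearMap.id ℝ (E × (E →L[ℝ] ℝ)) := by
      -- A point of the same fibre has the same base point, so this chart is its own preferred chart
      -- and has identity differential there.
      rw [← hyp]
      exact mfderiv_extChartAt_self (I := cotModel I) (x := y)
    have h3 : HasMFDerivAt 𝓘(ℝ, E × (E →L[ℝ] ℝ)) 𝓘(ℝ, E →L[ℝ] ℝ) ρ' (cotChart I ε.proj y) ρ' :=
      ρ'.hasFDerivAt.hasMFDerivAt
    have h4 := h3.comp y h1.hasMFDerivAt
    refine ⟨h4.mdifferentiableAt, fun u hu => ?_⟩
    have h5 : mfderiv (cotModel I) 𝓘(ℝ, E →L[ℝ] ℝ) (ρ' ∘ cotChart I ε.proj) y u =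
        ρ' (mfderiv (cotModel I) 𝓘(ℝ, E × (E →L[ℝ] ℝ)) (cotChart I ε.proj) y u) := by
      rw [h4.mfderiv]; rfl
    refine h5.trans ?_
    rw [h2]
    obtain ⟨h6, h7⟩ := (hreg.cotDeriv_eq_zero_iff hh y u).1 hu
    refine hρK (u : E × (E →L[ℝ] ℝ)).2 ((hK _).2 ?_)
    have h8 : (u : E × (E →L[ℝ] ℝ)) = (0, (u : E × (E →L[ℝ] ℝ)).2) := Prod.ext h6 rfl
    rw [h8] at h7
    exact hreg.velDeriv_eq_zero_of_eq hh hy.symm h7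
  -- the fibre is transversal to the complement of `K`
  have : CompleteSpace (E × (E →L[ℝ] ℝ)) := FiniteDimensional.complete ℝ _
  have : CompleteSpace F := FiniteDimensional.complete ℝ F
  let f : E × (E →L[ℝ] ℝ) → F := fun z =>
    extChartAt J (Fh ε) (Fh ((cotChart I ε.proj).symm z))
  have hf : HasStrictFDerivAt f (cotDeriv J Fh ε) (cotChart I ε.proj ε) := by
    have hsm := hreg.submersion.contMDiff ε
    have h1 : ContDiffAt ℝ ∞ f (cotChart I ε.proj ε) := by
      have := (contMDiffAt_iff.1 hsm).2
      rw [ModelWithCorners.range_eq_univ, contDiffWithinAt_univ] at this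
      exact this
    have h2 : HasFDerivAt f (cotDeriv J Fh ε) (cotChart I ε.proj ε) := by
      have := (hsm.mdifferentiableAt (by simp)).hasMFDerivAt.2
      rw [ModelWithCorners.range_eq_univ] at this
      exact HasFDerivWithinAt.hasFDerivAt_of_univ this
    exact h1.hasStrictFDerivAt' h2 (by simp)
  let κ' : (E × (E →L[ℝ] ℝ)) →L[ℝ] (Fin m → ℝ) := κ.comp (ContinuousLinearMap.snd ℝ E (E →L[ℝ] ℝ))
  have hΨ := hf.prodMk (κ'.hasStrictFDerivAt (x := cotChart I ε.proj ε))
  -- Lift `a` by surjectivity, then add a vector of K to adjust the κ-coordinate; this leaves `a`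
  -- unchanged because K lies in the kernel.
  have hsurj : ((cotDeriv J Fh ε).prod κ').range = ⊤ := by
    rw [LinearMap.range_eq_top]
    rintro ⟨a, k⟩
    obtain ⟨δ, hδ⟩ := hreg.cotDeriv_surjective ε a
    have hm : cotDeriv J Fh ε (0, s (k - κ δ.2)) = 0 :=
      (hreg.cotDeriv_eq_zero_iff hh ε _).2 ⟨rfl, hsK _⟩
    refine ⟨δ + (0, s (k - κ δ.2)), Prod.ext ?_ ?_⟩
    · change cotDeriv J Fh ε (δ + (0, s (k - κ δ.2))) = a
      rw [map_add, hm, hδ, add_zero]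
    · change κ (δ.2 + s (k - κ δ.2)) = k
      rw [map_add, hκs, add_sub_cancel]
  -- Surjectivity of the strict derivative makes the map open at this point: every κ-value near that
  -- of ε is attained on the fibre, by a point of the neighbourhood in `hU`.
  have hmap := hΨ.map_nhds_eq_of_surj hsurj
  have hU : ∀ᶠ z in 𝓝 (cotChart I ε.proj ε), z ∈ (cotChart I ε.proj).target ∧
      Fh ((cotChart I ε.proj).symm z) ∈ (extChartAt J (Fh ε)).source ∧
      (Fh ((cotChart I ε.proj).symm z) = Fh ε → ρ' z = ρ' (cotChart I ε.proj ε)) := by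
    have hc : Filter.Tendsto (cotChart I ε.proj).symm (𝓝 (cotChart I ε.proj ε)) (𝓝 ε) := by
      have := (cotChart_symm_contMDiffAt hz).continuousAt
      rwa [ContinuousAt, (cotChart I ε.proj).left_inv
        ((mem_cotChart_source I).2 (mem_chart_source H _))] at this
    have h1 : ∀ᶠ y in 𝓝 ε, Fh y ∈ (extChartAt J (Fh ε)).source :=
      hreg.submersion.contMDiff.continuous.continuousAt (extChartAt_source_mem_nhds (I := J) (Fh ε))
    filter_upwards [(isOpen_cotChart_target I ε.proj).mem_nhds hz, hc.eventually h1,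
      hc.eventually hloc] with z hz1 hz2 hz3
    refine ⟨hz1, hz2, fun hz4 => ?_⟩
    have := hz3 hz4
    rwa [(cotChart I ε.proj).right_inv hz1] at this
  have hV := Filter.image_mem_map (m := fun z => (f z, κ' z)) hU
  rw [hmap] at hV
  have hcont : ContinuousAt (fun γ : E →L[ℝ] ℝ => (f (cotChart I ε.proj ε), κ γ)) (mom ε) :=
    continuousAt_const.prodMk κ.continuous.continuousAt
  have hval : (f (cotChart I ε.proj ε), κ (mom ε)) =
      (f (cotChart I ε.proj ε), κ' (cotChart I ε.proj ε)) := by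
    rw [← hself]; rfl
  have hev := hcont.eventually (p := fun w => w ∈ (fun z => (f z, κ' z)) '' {z | z ∈ (cotChart I ε.proj).target ∧
      Fh ((cotChart I ε.proj).symm z) ∈ (extChartAt J (Fh ε)).source ∧
      (Fh ((cotChart I ε.proj).symm z) = Fh ε → ρ' z = ρ' (cotChart I ε.proj ε))}) (by
    change ∀ᶠ y in 𝓝 (f (cotChart I ε.proj ε), κ (mom ε)), _
    rw [hval]; exact hV)
  filter_upwards [hev] with γ hγ hγK
  obtain ⟨z, ⟨hz1, hz2, hz3⟩, hz4⟩ := hγ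
  have h1 : f z = f (cotChart I ε.proj ε) := congrArg Prod.fst hz4
  have h2 : κ z.2 = κ γ := congrArg Prod.snd hz4
  have hFε : f (cotChart I ε.proj ε) = extChartAt J (Fh ε) (Fh ε) := by
    simp only [f]
    rw [(cotChart I ε.proj).left_inv ((mem_cotChart_source I).2 (mem_chart_source H _))]
  rw [hFε] at h1
  have h3 : Fh ((cotChart I ε.proj).symm z) = Fh ε :=
    (extChartAt J (Fh ε)).injOn hz2 (mem_extChartAt_source (Fh ε)) h1
  have h4 : ρ z.2 = ρ (mom ε) := by
    have : ρ z.2 = ρ (cotChart I ε.proj ε).2 := hz3 h3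
    rwa [hself] at this
  have h5 : s (κ (γ - mom ε)) = γ - mom ε := hκ _ hγK
  -- `z.2` agrees with `γ` in the κ-coordinate and with `mom ε` modulo K; as `γ - mom ε` is in K,
  -- the two momenta coincide.
  have h6 : z.2 = γ := by
    rw [hρ, hρ, h2] at h4
    rw [map_sub, map_sub] at h5
    have h7 : z.2 = (mom ε - s (κ (mom ε))) + s (κ γ) := sub_eq_iff_eq_add.1 h4
    rw [h7, sub_add_eq_add_sub, add_sub_assoc, h5]
    exact add_sub_cancel _ _
  have h8 : (cotChart I ε.proj).symm z = (⟨ε.proj, γ⟩ : CotangentBundle I N) := by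
    have h9 := hreg.proj_eq_of_eq h3
    have h10 := (cotChart I ε.proj).right_inv hz1
    generalize (cotChart I ε.proj).symm z = y at h9 h10
    obtain ⟨x, p⟩ := y
    have h9' : x = ε.proj := h9
    subst h9'
    have h11 := congrArg Prod.snd h10
    have h12 : (cotChart I ε.proj (⟨ε.proj, p⟩ : CotangentBundle I N)).2 = p := by
      rw [cotChart_self I (⟨ε.proj, p⟩ : CotangentBundle I N)]
      rfl
    rw [h12, h6] at h11
    rw [h11]
  rw [← h8, h3]

end IsAlmostRegular

end Tulczyjew

/-! ### Descent of L and the equality of the two sets. -/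

namespace Tulczyjew

set_option synthInstance.maxHeartbeats 400000

section Covectors

variable {E : Type*} [NormedAddCommGroup E] [NormedSpace ℝ E]
  {H : Type*} [TopologicalSpace H]
  {I : ModelWithCorners ℝ E H}
  {N : Type*} [TopologicalSpace N] [ChartedSpace H N]

theorem ext_mom {μ μ' : CotangentBundle I N} (h1 : μ.proj = μ'.proj) (h2 : mom μ = mom μ') :
    μ = μ' := by
  obtain ⟨x, ν⟩ := μ
  obtain ⟨x', ν'⟩ := μ'
  have h1' : x = x' := h1
  subst h1'
  exact congrArg (TotalSpace.mk x) h2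

theorem mem_generatedSet_iff {F : Type*} [NormedAddCommGroup F] [NormedSpace ℝ F] {G : Type*}
    [TopologicalSpace G] {J : ModelWithCorners ℝ F G} {C : Type*} [TopologicalSpace C]
    [ChartedSpace G C] {ι : C → N} {f : C → ℝ} [IsManifold I ∞ N] {μ : CotangentBundle I N} :
    μ ∈ generatedSet I J ι f ↔ ∃ c, ι c = μ.proj ∧ ∀ u : F,
      mom μ (mfderiv J I ι c u : E) = (mfderiv J 𝓘(ℝ, ℝ) f c u : ℝ) := by
  constructor
  · rintro ⟨c, ν, rfl, hν⟩
    exact ⟨c, rfl, hν⟩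
  · rintro ⟨c, hc, hμ⟩
    obtain ⟨x, ν⟩ := μ
    have hc' : ι c = x := hc
    subst hc'
    exact ⟨c, ν, rfl, hμ⟩

variable [IsManifold I ∞ N]

theorem mom_alpha (z : TangentBundle (cotModel I) (CotangentBundle I N)) (w : E × E) :
    mom (alpha I z) w = (z.snd : E × (E →L[ℝ] ℝ)).2 w.1 + mom z.proj w.2 := rfl

/-- The base point of the value returns q and q̇; testing the covector on `(e, 0)` and `(0, e)`
returns ṗ and p. -/
theorem alpha_injective : Function.Injective (alpha I (N := N)) := by
  rintro ⟨⟨x, p⟩, a⟩ ⟨⟨x', p'⟩, a'⟩ h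
  have h1 : x = x' := congrArg (fun μ : CotangentBundle I.tangent (TangentBundle I N) => μ.proj.proj) h
  subst h1
  have h2 : (a : E × (E →L[ℝ] ℝ)).1 = (a' : E × (E →L[ℝ] ℝ)).1 := congrArg
    (fun μ : CotangentBundle I.tangent (TangentBundle I N) => (μ.proj.snd : E)) h
  have h3 : ∀ w : E × E, (a : E × (E →L[ℝ] ℝ)).2 w.1 +
      mom (⟨x, p⟩ : CotangentBundle I N) w.2 = (a' : E × (E →L[ℝ] ℝ)).2 w.1 +
      mom (⟨x, p'⟩ : CotangentBundle I N) w.2 := fun w => congrArg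
    (fun μ : CotangentBundle I.tangent (TangentBundle I N) => mom μ w) h
  have h4 : (a : E × (E →L[ℝ] ℝ)).2 = (a' : E × (E →L[ℝ] ℝ)).2 := by
    refine ContinuousLinearMap.ext fun e => ?_
    have := h3 (e, 0)
    simpa only [map_zero, add_zero] using this
  have h5 : mom (⟨x, p⟩ : CotangentBundle I N) = mom (⟨x, p'⟩ : CotangentBundle I N) := by
    refine ContinuousLinearMap.ext fun e => ?_
    have := h3 (0, e)
    simpa only [map_zero, zero_add] using this
  have h6 : a = (a' : E × (E →L[ℝ] ℝ)) := Prod.ext h2 h4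
  have h5' : p = p' := h5
  subst h5'
  exact congrArg (TotalSpace.mk _) h6

theorem continuous_mk [I.Boundaryless] (q : N) :
    Continuous fun p : E →L[ℝ] ℝ => (⟨q, p⟩ : CotangentBundle I N) := by
  refine continuous_iff_continuousAt.2 fun p => ?_
  have h1 : ∀ p : E →L[ℝ] ℝ, (⟨q, p⟩ : CotangentBundle I N) =
      (cotChart I q).symm (extChartAt I q q, p) := by
    intro p
    have h2 := cotChart_self I (⟨q, p⟩ : CotangentBundle I N)
    have h3 := (cotChart I q).left_inv ((mem_cotChart_source I).2
      (mem_chart_source H (⟨q, p⟩ : CotangentBundle I N).proj))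
    rw [← h3]
    exact congrArg (cotChart I q).symm h2
  simp only [h1]
  have hz : (extChartAt I q q, p) ∈ (cotChart I q).target := by
    rw [cotChart_target]
    exact ⟨mem_extChartAt_target q, mem_univ _⟩
  exact ContinuousAt.comp (cotChart_symm_contMDiffAt hz).continuousAt
    (continuousAt_const.prodMk continuousAt_id)

end Covectors

variable {E : Type*} [NormedAddCommGroup E] [NormedSpace ℝ E] [FiniteDimensional ℝ E]
  {H : Type*} [TopologicalSpace H]
  {I : ModelWithCorners ℝ E H} [I.Boundaryless]
  {N : Type*} [TopologicalSpace N] [ChartedSpace H N]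
  [IsManifold I ∞ N] {h : CotangentBundle I N → ℝ}
  {F : Type*} [NormedAddCommGroup F] [NormedSpace ℝ F] [FiniteDimensional ℝ F]
  {G : Type*} [TopologicalSpace G] {J : ModelWithCorners ℝ F G} [J.Boundaryless]
  {C : Type*} [TopologicalSpace C] [ChartedSpace G C] [IsManifold J ∞ C]
  {ι : C → TangentBundle I N} {Fh : CotangentBundle I N → C}

namespace IsAlmostRegular

/-- The fibres of the fibre derivative are invariant under translations by the kernel of the fibre
Hessian. -/
theorem fiber_translate (hreg : IsAlmostRegular I J h ι Fh)
    (hh : ContMDiff (cotModel I) 𝓘(ℝ, ℝ) ∞ h) {ε : CotangentBundle I N} {β : E →L[ℝ] ℝ}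
    (hβ : velDeriv h ε (0, β) = 0) :
    Fh ⟨ε.proj, mom ε + β⟩ = Fh ε := by
  -- Times at which the translate of ε along β stays in the fibre. This set contains 0 and is open
  -- and closed in ℝ, hence contains 1.
  let T : Set ℝ := {t | Fh ⟨ε.proj, mom ε + t • β⟩ = Fh ε}
  have hclosed : IsClosed T := by
    have := J.t1Space C
    have hc : Continuous fun t : ℝ => Fh ⟨ε.proj, mom ε + t • β⟩ :=
      hreg.submersion.contMDiff.continuous.comp ((continuous_mk ε.proj).comp (by fun_prop))
    exact isClosed_singleton.preimage hc
  have hopen : IsOpen T := by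
    rw [isOpen_iff_mem_nhds]
    intro t ht
    let ε' : CotangentBundle I N := ⟨ε.proj, mom ε + t • β⟩
    have ht' : Fh ε' = Fh ε := ht
    have h1 := hreg.fiber_open hh ε'
    have h2 : ContinuousAt (fun s : ℝ => mom ε + s • β) t := by fun_prop
    have h3 := h2.eventually (p := fun γ => velDeriv h ε' (0, γ - mom ε') = 0 →
      Fh ⟨ε'.proj, γ⟩ = Fh ε') h1
    filter_upwards [h3] with s hs
    have h4 : mom ε + s • β - mom ε' = (s - t) • β := by
      change mom ε + s • β - (mom ε + t • β) = _
      rw [add_sub_add_left_eq_sub]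
      exact (sub_smul s t β).symm
    -- The kernel of the Hessian is constant along the fibre, so β is still admissible at the new
    -- centre `ε'`.
    have h5 : velDeriv h ε' (0, (s - t) • β) = 0 := by
      have h6 := hreg.velDeriv_eq_zero_of_eq hh ht' hβ
      have h7 : ((0, (s - t) • β) : E × (E →L[ℝ] ℝ)) = (s - t) • ((0, β) : E × (E →L[ℝ] ℝ)) := by
        rw [Prod.smul_mk, smul_zero]
      rw [h7, map_smul, h6, smul_zero]
    rw [h4] at hs
    exact (hs h5).trans ht'
  have h0 : (0 : ℝ) ∈ T := by
    change Fh ⟨ε.proj, mom ε + (0 : ℝ) • β⟩ = Fh ε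
    rw [zero_smul, add_zero]
    rfl
  have h1 : (1 : ℝ) ∈ T := by
    rw [IsClopen.eq_univ ⟨hclosed, hopen⟩ ⟨0, h0⟩]
    exact mem_univ _
  have h2 : Fh ⟨ε.proj, mom ε + (1 : ℝ) • β⟩ = Fh ε := h1
  rwa [one_smul] at h2

variable {X : ∀ ε : CotangentBundle I N, TangentSpace (cotModel I) ε} {L : C → ℝ}

omit [FiniteDimensional ℝ F] [IsManifold J ∞ C] in
-- An arbitrary set-theoretic section of `Fh` suffices to define the function: constancy on fibres
-- makes it work at every ε, and surjectivity gives uniqueness.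
theorem exists_descent (hreg : IsAlmostRegular I J h ι Fh)
    (hh : ContMDiff (cotModel I) 𝓘(ℝ, ℝ) ∞ h) :
    ∃! L : C → ℝ, ∀ ε, L (Fh ε) = dilationDeriv I h ε - h ε := by
  choose s hs using hreg.surjective
  refine ⟨fun c => dilationDefect h (s c), fun ε => ?_, fun L hL => funext fun c => ?_⟩
  · exact hreg.dilationDefect_eq_of_eq hh (hs (Fh ε))
  · conv_lhs => rw [← hs c]
    exact hL _

omit [FiniteDimensional ℝ F] [IsManifold J ∞ C] in
theorem contMDiff_descent (hreg : IsAlmostRegular I J h ι Fh)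
    (hh : ContMDiff (cotModel I) 𝓘(ℝ, ℝ) ∞ h)
    (hL : ∀ ε, L (Fh ε) = dilationDeriv I h ε - h ε) : ContMDiff J 𝓘(ℝ, ℝ) ∞ L := by
  refine hreg.submersion.contMDiff_of_comp hreg.surjective ?_
  have : L ∘ Fh = dilationDefect h := funext hL
  rw [this]
  exact dilationDefect_contMDiff hh

omit [FiniteDimensional ℝ F] [IsManifold J ∞ C] in
-- Chain rule for L ∘ Fh = Δ^*h - h. As the differential of `Fh` is onto, this determines dL on the
-- whole tangent space of C.
theorem mfderiv_descent (hreg : IsAlmostRegular I J h ι Fh)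
    (hh : ContMDiff (cotModel I) 𝓘(ℝ, ℝ) ∞ h)
    (hL : ∀ ε, L (Fh ε) = dilationDeriv I h ε - h ε) (ε : CotangentBundle I N)
    (δ : E × (E →L[ℝ] ℝ)) :
    (mfderiv J 𝓘(ℝ, ℝ) L (Fh ε) (cotDeriv J Fh ε δ) : ℝ) =
      mom ε (velDeriv h ε δ) - basePart h ε.proj (cotChart I ε.proj ε) δ.1 := by
  have h1 := ((hreg.contMDiff_descent hh hL (Fh ε)).mdifferentiableAt (by simp)).hasMFDerivAt
  have h2 := ((hreg.submersion.contMDiff ε).mdifferentiableAt (by simp)).hasMFDerivAt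
  have h3 := (h1.comp ε h2).mfderiv
  have h4 : L ∘ Fh = dilationDefect h := funext hL
  have h5 := congrArg (fun T => T δ) h3
  rw [h4] at h5
  exact h5.symm.trans (mfderiv_dilationDefect hh ε δ)

/-- The set generated by the descended function is the image of the Hamiltonian vector field under
Tulczyjew's map. -/
theorem alpha_image_eq_generatedSet (hreg : IsAlmostRegular I J h ι Fh)
    (hh : ContMDiff (cotModel I) 𝓘(ℝ, ℝ) ∞ h) (hX : IsHamiltonianVectorField I h X)
    (hL : ∀ ε, L (Fh ε) = dilationDeriv I h ε - h ε) :
    alpha I '' vectorFieldImage (cotModel I) X = generatedSet I.tangent J ι L := by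
  have hX' := (isHamiltonianVectorField_iff hh X).1 hX
  have hproj : ∀ ε, (alpha I ⟨ε, X ε⟩).proj = ι (Fh ε) := by
    intro ε
    rw [hreg.fiberDeriv_eq]
    have : (X ε : E × (E →L[ℝ] ℝ)).1 = (fiberDeriv I h ε).snd := by
      rw [hX' ε]; exact velPart_self hh ε
    exact congrArg (TotalSpace.mk ε.proj) this
  have hmom : ∀ ε (w : E × E), mom (alpha I ⟨ε, X ε⟩) w =
      -basePart h ε.proj (cotChart I ε.proj ε) w.1 + mom ε w.2 := by
    intro ε w
    rw [mom_alpha]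
    have : (X ε : E × (E →L[ℝ] ℝ)).2 = -basePart h ε.proj (cotChart I ε.proj ε) := by
      rw [hX' ε]
    exact congrArg (fun T : E →L[ℝ] ℝ => T w.1 + mom ε w.2) this
  apply Subset.antisymm
  · rintro _ ⟨_, ⟨ε, rfl⟩, rfl⟩
    refine mem_generatedSet_iff.2 ⟨Fh ε, (hproj ε).symm, fun u => ?_⟩
    obtain ⟨δ, rfl⟩ := hreg.cotDeriv_surjective ε u
    rw [hreg.mfderiv_descent hh hL]
    have h1 := hreg.inclDeriv_cotDeriv hh ε δ
    refine (congrArg (mom (alpha I ⟨ε, X ε⟩)) h1).trans ?_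
    rw [hmom]
    ring
  · intro μ hμ
    obtain ⟨c, hc, hμ⟩ := mem_generatedSet_iff.1 hμ
    -- The condition defining Σ_L, written at an arbitrary representative ε of `c`; it is used at
    -- two different ones below.
    have key : ∀ ε, Fh ε = c → ∀ δ : E × (E →L[ℝ] ℝ), mom μ (δ.1, velDeriv h ε δ) =
        mom ε (velDeriv h ε δ) - basePart h ε.proj (cotChart I ε.proj ε) δ.1 := by
      rintro ε rfl δ
      rw [← hreg.mfderiv_descent hh hL, ← hμ, ← hreg.inclDeriv_cotDeriv hh]
      rfl
    have hsplit : ∀ e f : E, mom μ (e, f) = mom μ (e, (0 : E)) + mom μ ((0 : E), f) := by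
      intro e f
      have : ((e, f) : E × E) = (e, 0) + (0, f) := by simp
      rw [this, map_add]
    -- α puts the momentum in the slot dual to v̇, so `b` is the only possible momentum of a
    -- preimage of μ.
    let b : E →L[ℝ] ℝ := ContinuousLinearMap.comp (M₂ := E × E) (mom μ) (ContinuousLinearMap.inr ℝ E E)
    have hb : ∀ f : E, b f = mom μ ((0 : E), f) := fun f => rfl
    obtain ⟨ε₀, hε₀⟩ := hreg.surjective c
    -- On vertical vectors `key` says that `b` and `mom ε₀` agree on the image of the Hessian; by
    -- symmetry their difference lies in its kernel.
    have hker : velDeriv h ε₀ (0, b - mom ε₀) = 0 := by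
      refine SeparatingDual.eq_iff_forall_dual_eq (R := ℝ) |>.2 fun γ => ?_
      rw [map_zero, velDeriv_symm hh]
      have := key ε₀ hε₀ (0, γ)
      rw [map_zero, sub_zero, ← hb] at this
      rw [sub_apply, this, sub_self]
    have hε := hreg.fiber_translate hh hker
    rw [add_sub_cancel, hε₀] at hε
    refine ⟨_, ⟨⟨ε₀.proj, b⟩, rfl⟩, ext_mom ?_ ?_⟩
    · exact (hproj _).trans ((congrArg ι hε).trans hc)
    · refine ContinuousLinearMap.ext fun w => ?_
      refine (hmom _ w).trans ?_
      -- At the representative with momentum `b` the terms b(velDeriv(e, 0)) on the two sides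
      -- cancel, leaving μ(e, 0) = -h_q e.
      have h1 := key _ hε (w.1, 0)
      obtain ⟨e, f⟩ := w
      have h2 := hsplit e f
      have h3 := hsplit e (velDeriv h ⟨ε₀.proj, b⟩ (e, 0))
      refine Eq.trans ?_ h2.symm
      have h4 := h3.symm.trans h1
      rw [← hb] at h4 ⊢
      have h5 : mom (⟨ε₀.proj, b⟩ : CotangentBundle I N) = b := rfl
      rw [h5] at h4 ⊢
      change -basePart h ε₀.proj (cotChart I ε₀.proj ⟨ε₀.proj, b⟩) e + b f = _
      change _ = b _ - basePart h ε₀.proj (cotChart I ε₀.proj ⟨ε₀.proj, b⟩) e at h4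
      linarith

end IsAlmostRegular

end Tulczyjew

/-! ### Change of charts and the local expression of α ∘ X. -/

namespace Tulczyjew

set_option synthInstance.maxHeartbeats 400000

section Charts

variable {V H P : Type*} [NormedAddCommGroup V] [NormedSpace ℝ V] [TopologicalSpace H]
  {I : ModelWithCorners ℝ V H} [I.Boundaryless] [TopologicalSpace P] [ChartedSpace H P]
  [IsManifold I ∞ P]

/-- The composition of a chart with a diffeomorphism between open subsets of the model space. -/
theorem exists_chart_trans {e₀ : OpenPartialHomeomorph P H}
    (he₀ : e₀ ∈ IsManifold.maximalAtlas I ∞ P) (A : OpenPartialHomeomorph V V)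
    (hA : ContDiffOn ℝ ∞ A A.source) (hA' : ContDiffOn ℝ ∞ A.symm A.target) :
    ∃ e ∈ IsManifold.maximalAtlas I ∞ P,
      e.source = e₀.source ∩ e₀.extend I ⁻¹' A.source ∧ ∀ y, e.extend I y = A (e₀.extend I y) := by
  let T : OpenPartialHomeomorph H V := I.toHomeomorph.toOpenPartialHomeomorph
  let e : OpenPartialHomeomorph P H := (e₀.trans (T.trans A)).trans T.symm
  have hsource : e.source = e₀.source ∩ e₀.extend I ⁻¹' A.source := by
    ext y
    simp [e, T]
  have hI : ContMDiff 𝓘(ℝ, V) I ∞ I.symm := by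
    have := I.contMDiffOn_symm (n := ∞)
    rwa [I.range_eq_univ, contMDiffOn_univ] at this
  have htarget : ∀ x, x ∈ e.target → I x ∈ A.target ∧ A.symm (I x) ∈ (e₀.extend I).target := by
    intro x hx
    have ht : (e₀.extend I).target = I.symm ⁻¹' e₀.target := by
      rw [e₀.extend_target, I.range_eq_univ, inter_univ]
    rw [ht]
    simpa [e, T] using hx
  refine ⟨e, ?_, hsource, fun y => ?_⟩
  · refine e.mem_maximalAtlas_of_contMDiffOn ?_ ?_
    · have h1 : ContMDiffOn I I ∞ (fun y => I.symm (A (e₀.extend I y))) e.source := by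
        refine hI.comp_contMDiffOn (hA.contMDiffOn.comp
          ((e₀.contMDiffOn_extend he₀).mono fun y hy => ?_) fun y hy => ?_)
        · rw [hsource] at hy; exact hy.1
        · rw [hsource] at hy; exact hy.2
      exact h1
    · have h1 : ContMDiffOn I I ∞ (fun x => (e₀.extend I).symm (A.symm (I x))) e.target := by
        have h2 : ContMDiffOn 𝓘(ℝ, V) I ∞ (e₀.extend I).symm (e₀.extend I).target := fun z hz =>
          (extend_symm_contMDiffAt he₀ hz).contMDiffWithinAt
        exact h2.comp (hA'.contMDiffOn.comp I.contMDiff.contMDiffOn fun x hx => (htarget x hx).1)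
          fun x hx => (htarget x hx).2
      exact h1
  · change I (I.symm (A (I (e₀ y)))) = A (I (e₀ y))
    exact I.right_inv (by rw [I.range_eq_univ]; exact mem_univ _)

end Charts

variable {E : Type*} [NormedAddCommGroup E] [NormedSpace ℝ E] [FiniteDimensional ℝ E]
  {H : Type*} [TopologicalSpace H]
  {I : ModelWithCorners ℝ E H} [I.Boundaryless]
  {N : Type*} [TopologicalSpace N] [ChartedSpace H N]
  [IsManifold I ∞ N] {h : CotangentBundle I N → ℝ}
  {X : ∀ ε : CotangentBundle I N, TangentSpace (cotModel I) ε}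

omit [FiniteDimensional ℝ E] [I.Boundaryless] in
-- Both curves project to σ, so both first components are the velocity of σ in the chart at σ(0).
theorem velocity_fst_eq {σ : ℝ → N} {p : ∀ t, CotangentSpace I (σ t)}
    {v : ∀ t, TangentSpace I (σ t)}
    (hp : MDifferentiableAt 𝓘(ℝ, ℝ) (cotModel I) (fun t => (⟨σ t, p t⟩ : CotangentBundle I N)) 0)
    (hv : MDifferentiableAt 𝓘(ℝ, ℝ) I.tangent (fun t => (⟨σ t, v t⟩ : TangentBundle I N)) 0) :
    ((velocity (cotModel I) (fun t => (⟨σ t, p t⟩ : CotangentBundle I N)) 0).snd :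
      E × (E →L[ℝ] ℝ)).1 =
    ((velocity I.tangent (fun t => (⟨σ t, v t⟩ : TangentBundle I N)) 0).snd : E × E).1 := by
  have h1 := velocity_snd (cotModel I) _ 0 hp
  have h2 := velocity_snd I.tangent _ 0 hv
  simp only [extChartAt_cot] at h1
  simp only [extChartAt_tangent] at h2
  have h1' := (ContinuousLinearMap.fst ℝ E (E →L[ℝ] ℝ)).hasFDerivAt.comp_hasDerivAt 0 h1
  have h2' := (ContinuousLinearMap.fst ℝ E E).hasFDerivAt.comp_hasDerivAt 0 h2
  exact h1'.unique h2'

/-- The covector `α(X(ε))` is the differential of the function `⟨p, v⟩ - h(p)` on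
`T*N ×_N TN`. -/
theorem hasDerivAt_pairing_sub (hh : ContMDiff (cotModel I) 𝓘(ℝ, ℝ) ∞ h)
    (hX : IsHamiltonianVectorField I h X) {σ : ℝ → N} {p : ∀ t, CotangentSpace I (σ t)}
    {v : ∀ t, TangentSpace I (σ t)}
    (hp : MDifferentiableAt 𝓘(ℝ, ℝ) (cotModel I) (fun t => (⟨σ t, p t⟩ : CotangentBundle I N)) 0)
    (hv : MDifferentiableAt 𝓘(ℝ, ℝ) I.tangent (fun t => (⟨σ t, v t⟩ : TangentBundle I N)) 0)
    (hv₀ : v 0 = (fiberDeriv I h ⟨σ 0, p 0⟩).snd) :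
    HasDerivAt (fun t => (p t (v t) : ℝ) - h ⟨σ t, p t⟩)
      (mom (alpha I ⟨⟨σ 0, p 0⟩, X ⟨σ 0, p 0⟩⟩)
        ((velocity I.tangent (fun t => (⟨σ t, v t⟩ : TangentBundle I N)) 0).snd : E × E)) 0 := by
  have h1 := tangentPairing_velocity I σ p v hp hv
  have h2 := ((hh _).mdifferentiableAt (by simp)).hasMFDerivAt.comp (0:ℝ) hp.hasMFDerivAt
  let D : ℝ →L[ℝ] ℝ :=
    ContinuousLinearMap.comp (M₁ := ℝ) (M₃ := ℝ) (mfderiv (cotModel I) 𝓘(ℝ, ℝ) h ⟨σ 0, p 0⟩)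
      (mfderiv 𝓘(ℝ, ℝ) (cotModel I) (fun t => (⟨σ t, p t⟩ : CotangentBundle I N)) 0)
  have h3 : HasFDerivAt (fun t : ℝ => h ⟨σ t, p t⟩) D 0 := h2.hasFDerivAt
  refine (h1.sub h3.hasDerivAt).congr_deriv ?_
  let ε : CotangentBundle I N := ⟨σ 0, p 0⟩
  let ζ : E × (E →L[ℝ] ℝ) :=
    (velocity (cotModel I) (fun t => (⟨σ t, p t⟩ : CotangentBundle I N)) 0).snd
  let w : E × E := (velocity I.tangent (fun t => (⟨σ t, v t⟩ : TangentBundle I N)) 0).snd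
  let x : E × (E →L[ℝ] ℝ) := X ε
  let v₀ : E := v 0
  have h4 : ζ.1 = w.1 := velocity_fst_eq hp hv
  have h5 : (differential (cotModel I) h ε ζ : ℝ) = ζ.2 x.1 - x.2 ζ.1 :=
    (hX ε ζ).symm.trans (canonicalForm_apply I _ _ _)
  have h6 : x.1 = v₀ := by
    have : x = (velPart h ε.proj (cotChart I ε.proj ε), -basePart h ε.proj (cotChart I ε.proj ε)) :=
      (isHamiltonianVectorField_iff hh X).1 hX ε
    rw [this]
    exact (velPart_self hh ε).trans hv₀.symm
  -- The term ⟨ṗ, v⟩ of the pairing cancels against ⟨ṗ, h_p⟩ in dh, precisely because the vector at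
  -- time 0 is the fibre derivative.
  have h7 : ζ.2 v₀ + mom ε w.2 - (differential (cotModel I) h ε ζ : ℝ) = x.2 w.1 + mom ε w.2 := by
    rw [h5, h6, ← h4]; ring
  exact h7

/-- The local expression of `α ∘ X` for the Hamiltonian vector field `X` of `h`. -/
def localSection (h : CotangentBundle I N → ℝ) (q : N) (z : E × (E →L[ℝ] ℝ)) :
    (E × E) × ((E × E) →L[ℝ] ℝ) :=
  ((z.1, velPart h q z), z.2.comp (ContinuousLinearMap.snd ℝ E E) -
    (basePart h q z).comp (ContinuousLinearMap.fst ℝ E E))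

omit [FiniteDimensional ℝ E] [I.Boundaryless] in
theorem extChartAt_tangent_symm_mem {a : TangentBundle I N} {x v : E}
    (hx : x ∈ (extChartAt I a.proj).target) : ((x, v) : E × E) ∈ (extChartAt I.tangent a).target := by
  rw [FiberBundle.extChartAt_target]
  refine ⟨⟨hx, ?_⟩, mem_univ _⟩
  have := (extChartAt I a.proj).map_target hx
  rw [extChartAt_source] at this
  simpa using this

/-- The local expression of `α ∘ X` in the induced charts. -/
theorem cotChart_alpha (hh : ContMDiff (cotModel I) 𝓘(ℝ, ℝ) ∞ h)
    (hX : IsHamiltonianVectorField I h X) (a : TangentBundle I N) {ε : CotangentBundle I N}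
    (hε : ε.proj ∈ (chartAt H a.proj).source) :
    cotChart I.tangent a (alpha I ⟨ε, X ε⟩) = localSection h a.proj (cotChart I a.proj ε) := by
  have hfib : ∀ ε, (alpha I ⟨ε, X ε⟩).proj = fiberDeriv I h ε := by
    intro ε
    have : (X ε : E × (E →L[ℝ] ℝ)).1 = (fiberDeriv I h ε).snd := by
      rw [(isHamiltonianVectorField_iff hh X).1 hX ε]; exact velPart_self hh ε
    exact congrArg (TotalSpace.mk ε.proj) this
  have hbase : extChartAt I a.proj ε.proj = (cotChart I a.proj ε).1 := by rw [cotChart_apply]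
  have hfibmem : fiberDeriv I h ε ∈ (chartAt (ModelProd H E) a).source :=
    (TangentBundle.mem_chart_source_iff _ _).2 hε
  rw [cotChart_apply]
  refine Prod.ext ?_ ?_
  · rw [hfib, extChartAt_tangent]
    exact Prod.ext hbase (triv_fiberDeriv hh hε)
  refine ContinuousLinearMap.ext ?_
  rintro ⟨e, f⟩
  have hz := cotChart_mem_target (I := I) hε
  rcases hzx : cotChart I a.proj ε with ⟨x, p⟩
  rw [hzx] at hz hbase
  have hxt : x ∈ (extChartAt I a.proj).target := by
    rw [cotChart_target] at hz; exact hz.1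
  have hv0 : (trivializationAt E (TangentSpace I) a.proj (fiberDeriv I h ε)).2 =
      velPart h a.proj (x, p) := by
    rw [← hzx]; exact triv_fiberDeriv hh hε
  let Tr := trivializationAt E (TangentSpace I : N → Type _) a.proj
  -- The covector component is found without transforming second-order coordinates. Along curves
  -- with chart coordinates x + te, v + tf and constant p, the function ⟨p, v⟩ - h is differentiated
  -- intrinsically, giving α(X(ε)) on the velocity, and in the chart, giving p f - h_q e.
  let xt : ℝ → E := fun t => x + t • e
  let vt : ℝ → E := fun t => velPart h a.proj (x, p) + t • f
  let σ : ℝ → N := fun t => (extChartAt I a.proj).symm (xt t)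
  let pt : ∀ t, CotangentSpace I (σ t) := fun t =>
    ContinuousLinearMap.comp (M₂ := E) p (Tr.continuousLinearMapAt ℝ (σ t))
  let v : ∀ t, TangentSpace I (σ t) := fun t => Tr.symmL ℝ (σ t) (vt t)
  have hxtc : Continuous xt := by fun_prop
  have hev : ∀ᶠ t in 𝓝 (0 : ℝ), xt t ∈ (extChartAt I a.proj).target := by
    refine hxtc.continuousAt ((isOpen_extChartAt_target (I := I) a.proj).mem_nhds ?_)
    simpa [xt] using hxt
  have hσs : ∀ t, xt t ∈ (extChartAt I a.proj).target → σ t ∈ (chartAt H a.proj).source := by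
    intro t ht
    have := (extChartAt I a.proj).map_target ht
    rwa [extChartAt_source] at this
  have hpc : ∀ t, xt t ∈ (extChartAt I a.proj).target →
      cotChart I a.proj ⟨σ t, pt t⟩ = (xt t, p) := by
    intro t ht
    rw [cotChart_apply]
    refine Prod.ext ((extChartAt I a.proj).right_inv ht) ?_
    refine ContinuousLinearMap.ext fun w => ?_
    exact congrArg p (continuousLinearMapAt_symmL_tangent (hσs t ht) w)
  have hvT : ∀ t, xt t ∈ (extChartAt I a.proj).target →
      (Tr (⟨σ t, v t⟩ : TangentBundle I N)).2 = vt t := by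
    intro t ht
    rw [← continuousLinearMapAt_eq_triv (hσs t ht)]
    exact continuousLinearMapAt_symmL_tangent (hσs t ht) (vt t)
  have hvc : ∀ t, xt t ∈ (extChartAt I a.proj).target →
      extChartAt I.tangent a ⟨σ t, v t⟩ = ((xt t, vt t) : E × E) := by
    intro t ht
    rw [extChartAt_tangent]
    exact Prod.ext ((extChartAt I a.proj).right_inv ht) (hvT t ht)
  have h0 : xt 0 = x := by simp [xt]
  have h0t : xt 0 ∈ (extChartAt I a.proj).target := by rwa [h0]
  have hp : MDifferentiableAt 𝓘(ℝ, ℝ) (cotModel I)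
      (fun t => (⟨σ t, pt t⟩ : CotangentBundle I N)) 0 := by
    have h1 : MDifferentiableAt 𝓘(ℝ, ℝ) 𝓘(ℝ, E × (E →L[ℝ] ℝ)) (fun t => (xt t, p)) 0 := by
      refine DifferentiableAt.mdifferentiableAt ?_
      fun_prop
    have h2 : MDifferentiableAt 𝓘(ℝ, E × (E →L[ℝ] ℝ)) (cotModel I) (cotChart I a.proj).symm
        (xt 0, p) :=
      (cotChart_symm_contMDiffAt (by rwa [h0])).mdifferentiableAt (by simp)
    refine (h2.comp (0:ℝ) h1).congr_of_eventuallyEq ?_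
    filter_upwards [hev] with t ht
    rw [Function.comp_apply, ← hpc t ht]
    exact ((cotChart I a.proj).left_inv ((mem_cotChart_source I).2 (hσs t ht))).symm
  have hv : MDifferentiableAt 𝓘(ℝ, ℝ) I.tangent (fun t => (⟨σ t, v t⟩ : TangentBundle I N)) 0 := by
    have h1 : MDifferentiableAt 𝓘(ℝ, ℝ) 𝓘(ℝ, E × E) (fun t => (xt t, vt t)) 0 := by
      refine DifferentiableAt.mdifferentiableAt ?_
      fun_prop
    have h2 : MDifferentiableAt 𝓘(ℝ, E × E) I.tangent (extChartAt I.tangent a).symm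
        ((xt 0, vt 0) : E × E) :=
      (extend_symm_contMDiffAt (n := ∞) (IsManifold.chart_mem_maximalAtlas a)
        (extChartAt_tangent_symm_mem h0t)).mdifferentiableAt (by simp)
    refine (h2.comp (0:ℝ) h1).congr_of_eventuallyEq ?_
    filter_upwards [hev] with t ht
    rw [Function.comp_apply, ← hvc t ht]
    refine ((extChartAt I.tangent a).left_inv ?_).symm
    rw [extChartAt_source]
    exact (TangentBundle.mem_chart_source_iff _ _).2 (hσs t ht)
  have hε0 : (⟨σ 0, pt 0⟩ : CotangentBundle I N) = ε := by
    refine (cotChart I a.proj).injOn ((mem_cotChart_source I).2 (hσs 0 h0t))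
      ((mem_cotChart_source I).2 hε) ?_
    rw [hpc 0 h0t, h0, hzx]
  have hv0' : (⟨σ 0, v 0⟩ : TangentBundle I N) = fiberDeriv I h ε := by
    refine (extChartAt I.tangent a).injOn ?_ ?_ ?_
    · rw [extChartAt_source]
      exact (TangentBundle.mem_chart_source_iff _ _).2 (hσs 0 h0t)
    · rwa [extChartAt_source]
    · rw [hvc 0 h0t, extChartAt_tangent, hv0, h0]
      refine Prod.ext hbase.symm ?_
      simp [vt]
  have hv0s : v 0 = (fiberDeriv I h ⟨σ 0, pt 0⟩).snd := by
    have h1 : (⟨σ 0, v 0⟩ : TangentBundle I N) = fiberDeriv I h ⟨σ 0, pt 0⟩ := by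
      rw [hε0]; exact hv0'
    have h2 : (⟨σ 0, v 0⟩ : TangentBundle I N) =
      ⟨σ 0, (fiberDeriv I h ⟨σ 0, pt 0⟩).snd⟩ := h1
    exact eq_of_heq (TotalSpace.mk.inj h2).2
  have key := hasDerivAt_pairing_sub hh hX hp hv hv0s
  rw [hε0] at key
  have hxd : HasDerivAt xt e 0 := by
    simpa [xt] using ((hasDerivAt_id (0:ℝ)).smul_const e).const_add x
  have hvd : HasDerivAt vt f 0 := by
    simpa [vt] using ((hasDerivAt_id (0:ℝ)).smul_const f).const_add (velPart h a.proj (x, p))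
  have hloc : HasDerivAt (fun t => p (vt t) - localRep I h a.proj (xt t, p))
      (p f - basePart h a.proj (x, p) e) 0 := by
    have h1 : HasFDerivAt (localRep I h a.proj) (fderiv ℝ (localRep I h a.proj) (x, p))
        (xt 0, p) := by
      rw [h0]; exact ((localRep_contDiffAt hh hz).differentiableAt (by simp)).hasFDerivAt
    have h2 := h1.comp_hasDerivAt (0:ℝ) (hxd.prodMk (hasDerivAt_const (0:ℝ) p))
    exact (p.hasFDerivAt.comp_hasDerivAt (0:ℝ) hvd).sub h2
  have hcongr : (fun t => (pt t (v t) : ℝ) - h ⟨σ t, pt t⟩) =ᶠ[𝓝 0]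
      fun t => p (vt t) - localRep I h a.proj (xt t, p) := by
    filter_upwards [hev] with t ht
    have h1 : (pt t (v t) : ℝ) = p (vt t) :=
      congrArg p (continuousLinearMapAt_symmL_tangent (hσs t ht) (vt t))
    have h2 : h ⟨σ t, pt t⟩ = localRep I h a.proj (xt t, p) := by
      rw [← hpc t ht, localRep_apply (hσs t ht)]
    exact congrArg₂ (fun r s : ℝ => r - s) h1 h2
  have hval := (key.congr_of_eventuallyEq hcongr.symm).unique hloc
  have hc0 : (⟨σ 0, v 0⟩ : TangentBundle I N) ∈ (chartAt (ModelProd H E) a).source :=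
    (TangentBundle.mem_chart_source_iff _ _).2 (hσs 0 h0t)
  -- In the trivialization at `a` the velocity has components `(e, f)`, so it is the vector on which
  -- the chart expression evaluates the covector.
  have htv : (trivializationAt (E × E) (TangentSpace I.tangent) a
      (velocity I.tangent (fun t => (⟨σ t, v t⟩ : TangentBundle I N)) 0)).2 = ((e, f) : E × E) := by
    refine triv_velocity I.tangent a _ 0 hv hc0 ?_
    refine (hxd.prodMk hvd).congr_of_eventuallyEq ?_
    filter_upwards [hev] with t ht using hvc t ht
  let Gs : TangentBundle I N → E × E := fun y =>
    (trivializationAt (E × E) (TangentSpace I.tangent : TangentBundle I N → Type _) a).symmL ℝ y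
      ((e, f) : E × E)
  have hGs : Gs (alpha I ⟨ε, X ε⟩).proj =
      ((velocity I.tangent (fun t => (⟨σ t, v t⟩ : TangentBundle I N)) 0).snd : E × E) := by
    rw [hfib, ← hv0']
    have h1 := symmL_continuousLinearMapAt_tangent (I := I.tangent) hc0
      (velocity I.tangent (fun t => (⟨σ t, v t⟩ : TangentBundle I N)) 0).snd
    refine Eq.trans ?_ h1
    exact congrArg (fun w : E × E => ((trivializationAt (E × E)
      (TangentSpace I.tangent : TangentBundle I N → Type _) a).symmL ℝ ⟨σ 0, v 0⟩ w : E × E))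
      htv.symm
  have hfin : mom (alpha I ⟨ε, X ε⟩) (Gs (alpha I ⟨ε, X ε⟩).proj) =
      p f - basePart h a.proj (x, p) e := (congrArg (mom (alpha I ⟨ε, X ε⟩)) hGs).trans hval
  exact hfin

end Tulczyjew

/-! ### Straightening the image of α ∘ X to a linear Lagrangian slice. -/

section Shear

variable {V Z : Type*} [NormedAddCommGroup V] [NormedSpace ℝ V] [NormedAddCommGroup Z]
  [NormedSpace ℝ Z]

/-- The shear `w ↦ w - s (c w)` along a map `s` with values in the kernel of `c`. -/
def OpenPartialHomeomorph.shear (c : V →L[ℝ] Z) (s : Z → V) (U : Set Z) (hU : IsOpen U)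
    (hs : ContinuousOn s U) (hcs : ∀ z, c (s z) = 0) : OpenPartialHomeomorph V V where
  toFun w := w - s (c w)
  invFun w := w + s (c w)
  source := c ⁻¹' U
  target := c ⁻¹' U
  map_source' w hw := by
    rw [mem_preimage, map_sub, hcs, sub_zero]; exact hw
  map_target' w hw := by
    rw [mem_preimage, map_add, hcs, add_zero]; exact hw
  left_inv' w _ := by
    rw [map_sub, hcs, sub_zero, sub_add_cancel]
  right_inv' w _ := by
    rw [map_add, hcs, add_zero, add_sub_cancel_right]
  open_source := hU.preimage c.continuous
  open_target := hU.preimage c.continuous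
  continuousOn_toFun := continuousOn_id.sub (hs.comp c.continuous.continuousOn fun _ hw => hw)
  continuousOn_invFun := continuousOn_id.add (hs.comp c.continuous.continuousOn fun _ hw => hw)

end Shear

namespace Tulczyjew

set_option synthInstance.maxHeartbeats 400000

section Linear

variable (E : Type*) [NormedAddCommGroup E] [NormedSpace ℝ E]

/-- The inclusion `(x, p) ↦ (x, 0, 0, p)` of `E × E*` into `(E × E) × (E × E)*`. -/
def sliceIncl : (E × (E →L[ℝ] ℝ)) →L[ℝ] (E × E) × ((E × E) →L[ℝ] ℝ) :=
  ((ContinuousLinearMap.inl ℝ E E).comp (ContinuousLinearMap.fst ℝ E (E →L[ℝ] ℝ))).prod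
    (((ContinuousLinearMap.compL ℝ (E × E) E ℝ).flip (ContinuousLinearMap.snd ℝ E E)).comp
      (ContinuousLinearMap.snd ℝ E (E →L[ℝ] ℝ)))

/-- The projection `(x, v, b, p) ↦ (x, p)` of `(E × E) × (E × E)*` onto `E × E*`. -/
def sliceProj : (E × E) × ((E × E) →L[ℝ] ℝ) →L[ℝ] (E × (E →L[ℝ] ℝ)) :=
  ((ContinuousLinearMap.fst ℝ E E).comp (ContinuousLinearMap.fst ℝ (E × E) _)).prod
    (((ContinuousLinearMap.compL ℝ E (E × E) ℝ).flip (ContinuousLinearMap.inr ℝ E E)).comp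
      (ContinuousLinearMap.snd ℝ (E × E) ((E × E) →L[ℝ] ℝ)))

theorem sliceProj_sliceIncl (z : E × (E →L[ℝ] ℝ)) : sliceProj E (sliceIncl E z) = z := rfl

theorem sliceIncl_injective : Function.Injective (sliceIncl E) :=
  Function.LeftInverse.injective (sliceProj_sliceIncl E)

theorem finrank_range_sliceIncl [FiniteDimensional ℝ E] :
    2 * Module.finrank ℝ (LinearMap.range (sliceIncl E).toLinearMap) =
      Module.finrank ℝ ((E × E) × ((E × E) →L[ℝ] ℝ)) := by
  have hdual : ∀ (W : Type _) [NormedAddCommGroup W] [NormedSpace ℝ W] [FiniteDimensional ℝ W],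
      Module.finrank ℝ (W →L[ℝ] ℝ) = Module.finrank ℝ W := by
    intro W _ _ _
    rw [← (LinearMap.toContinuousLinearMap (𝕜 := ℝ) (E := W) (F' := ℝ)).finrank_eq,
      Module.finrank_linearMap_self]
  rw [LinearMap.finrank_range_of_inj (sliceIncl_injective E), Module.finrank_prod,
    Module.finrank_prod, Module.finrank_prod, hdual, hdual, Module.finrank_prod]
  ring

end Linear

variable {E : Type*} [NormedAddCommGroup E] [NormedSpace ℝ E] [FiniteDimensional ℝ E]
  {H : Type*} [TopologicalSpace H]
  {I : ModelWithCorners ℝ E H} [I.Boundaryless]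
  {N : Type*} [TopologicalSpace N] [ChartedSpace H N]
  [IsManifold I ∞ N] {h : CotangentBundle I N → ℝ}
  {X : ∀ ε : CotangentBundle I N, TangentSpace (cotModel I) ε}

/-- The components of `α ∘ X` transverse to the slice `(x, 0, 0, p)`. -/
def localShear (h : CotangentBundle I N → ℝ) (q : N) (z : E × (E →L[ℝ] ℝ)) :
    (E × E) × ((E × E) →L[ℝ] ℝ) :=
  ((0, velPart h q z), -(basePart h q z).comp (ContinuousLinearMap.fst ℝ E E))

omit [I.Boundaryless] in
-- The image is a graph over the slice: a linear part plus a transverse part which `sliceProj`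
-- kills. Subtracting the latter is the shear that flattens it.
theorem localSection_eq (h : CotangentBundle I N → ℝ) (q : N) (z : E × (E →L[ℝ] ℝ)) :
    localSection h q z = sliceIncl E z + localShear h q z := by
  refine Prod.ext (Prod.ext ?_ ?_) ?_
  · exact (add_zero z.1).symm
  · exact (zero_add _).symm
  · exact sub_eq_add_neg _ _

omit [I.Boundaryless] in
theorem sliceProj_localShear (h : CotangentBundle I N → ℝ) (q : N) (z : E × (E →L[ℝ] ℝ)) :
    sliceProj E (localShear h q z) = 0 := by
  refine Prod.ext rfl (ContinuousLinearMap.ext fun w => ?_)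
  change -(basePart h q z 0) = 0
  rw [map_zero, neg_zero]

omit [I.Boundaryless] in
theorem sliceProj_localSection (h : CotangentBundle I N → ℝ) (q : N) (z : E × (E →L[ℝ] ℝ)) :
    sliceProj E (localSection h q z) = z := by
  rw [localSection_eq, map_add, sliceProj_localShear, add_zero, sliceProj_sliceIncl]

/-- The linear map sending the differential of a function to its transverse components. -/
def shearMap (E : Type*) [NormedAddCommGroup E] [NormedSpace ℝ E] [FiniteDimensional ℝ E] :
    ((E × (E →L[ℝ] ℝ)) →L[ℝ] ℝ) →L[ℝ] (E × E) × ((E × E) →L[ℝ] ℝ) :=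
  ((ContinuousLinearMap.inr ℝ E E).comp (velMap E)).prod
    (-((ContinuousLinearMap.compL ℝ (E × E) (E × (E →L[ℝ] ℝ)) ℝ).flip
      ((ContinuousLinearMap.inl ℝ E (E →L[ℝ] ℝ)).comp (ContinuousLinearMap.fst ℝ E E))))

omit [I.Boundaryless] in
theorem localShear_eq (h : CotangentBundle I N → ℝ) (q : N) :
    localShear h q = shearMap E ∘ fderiv ℝ (localRep I h q) := rfl

theorem localShear_contDiffAt (hh : ContMDiff (cotModel I) 𝓘(ℝ, ℝ) ∞ h) {q : N}
    {z : E × (E →L[ℝ] ℝ)} (hz : z ∈ (cotChart I q).target) :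
    ContDiffAt ℝ ∞ (localShear h q) z := by
  rw [localShear_eq]
  exact (shearMap E).contDiff.contDiffAt.comp z (fderiv_localRep_contDiffAt hh hz)

/-- The differential of `localSection`. -/
def localSectionDeriv (h : CotangentBundle I N → ℝ) (q : N) (z : E × (E →L[ℝ] ℝ)) :
    (E × (E →L[ℝ] ℝ)) →L[ℝ] (E × E) × ((E × E) →L[ℝ] ℝ) :=
  sliceIncl E + (shearMap E).comp (fderiv ℝ (fderiv ℝ (localRep I h q)) z)

theorem hasFDerivAt_localSection (hh : ContMDiff (cotModel I) 𝓘(ℝ, ℝ) ∞ h) {q : N}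
    {z : E × (E →L[ℝ] ℝ)} (hz : z ∈ (cotChart I q).target) :
    HasFDerivAt (localSection h q) (localSectionDeriv h q z) z := by
  have h1 := ((fderiv_localRep_contDiffAt hh hz).differentiableAt (by simp)).hasFDerivAt
  have h2 := (sliceIncl E).hasFDerivAt (x := z) |>.add ((shearMap E).hasFDerivAt.comp z h1)
  refine h2.congr_of_eventuallyEq (Filter.Eventually.of_forall fun w => ?_)
  rw [localSection_eq, localShear_eq]
  rfl

/-- The image of `localSection` is isotropic. -/
theorem localSectionDeriv_isotropic (hh : ContMDiff (cotModel I) 𝓘(ℝ, ℝ) ∞ h) {q : N}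
    {z : E × (E →L[ℝ] ℝ)} (hz : z ∈ (cotChart I q).target) (δ δ' : E × (E →L[ℝ] ℝ)) :
    (localSectionDeriv h q z δ').2 (localSectionDeriv h q z δ).1 -
      (localSectionDeriv h q z δ).2 (localSectionDeriv h q z δ').1 = 0 := by
  set D := fderiv ℝ (fderiv ℝ (localRep I h q)) z with hD
  -- Antisymmetrizing this expression in δ and δ' gives D δ δ' - D δ' δ, which vanishes by symmetry
  -- of the second derivative.
  have h1 : ∀ δ δ' : E × (E →L[ℝ] ℝ),
      (localSectionDeriv h q z δ').2 (localSectionDeriv h q z δ).1 =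
        D δ (0, δ'.2) - D δ' (δ.1, 0) := by
    intro δ δ'
    have h2 : (localSectionDeriv h q z δ').2 (localSectionDeriv h q z δ).1 =
        δ'.2 (0 + velMap E (D δ)) + -(D δ' (δ.1 + 0, 0)) := rfl
    rw [h2, zero_add, add_zero, apply_velMap, sub_eq_add_neg]
  have h3 : ∀ δ δ' : E × (E →L[ℝ] ℝ), D δ δ' = D δ (δ'.1, 0) + D δ (0, δ'.2) := by
    intro δ δ'
    rw [← map_add]
    simp
  have h4 : D δ δ' = D δ' δ := fderiv_fderiv_localRep_symm hh hz δ δ'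
  rw [h1, h1]
  rw [h3 δ δ', h3 δ' δ] at h4
  linarith

omit [FiniteDimensional ℝ E] [I.Boundaryless] in
theorem alpha_mem_source {a : TangentBundle I N} {ε : CotangentBundle I N}
    (hε : ε.proj ∈ (chartAt H a.proj).source) :
    alpha I ⟨ε, X ε⟩ ∈ (cotChart I.tangent a).source := by
  rw [mem_cotChart_source]
  exact (TangentBundle.mem_chart_source_iff _ _).2 hε

/-- In the preferred charts at ε and at its image the map is exactly `localSection`, since both
charts come from the chart of the base manifold at `ε.proj`. Continuity is recovered from the same
local expression. -/
theorem hasMFDerivAt_alpha (hh : ContMDiff (cotModel I) 𝓘(ℝ, ℝ) ∞ h)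
    (hX : IsHamiltonianVectorField I h X) (ε : CotangentBundle I N) :
    HasMFDerivAt (cotModel I) (cotModel I.tangent) (fun ε => alpha I ⟨ε, X ε⟩) ε
      (localSectionDeriv h ε.proj (cotChart I ε.proj ε)) := by
  have hε : ε.proj ∈ (chartAt H ε.proj).source := mem_chart_source H _
  have hz := cotChart_mem_target (I := I) hε
  have hs := hasFDerivAt_localSection hh hz
  let a : TangentBundle I N := (alpha I ⟨ε, X ε⟩).proj
  have halpha : ∀ ε' : CotangentBundle I N, ε'.proj ∈ (chartAt H ε.proj).source →
      cotChart I.tangent a (alpha I ⟨ε', X ε'⟩) = localSection h ε.proj (cotChart I ε.proj ε') :=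
    fun ε' hε' => cotChart_alpha hh hX a hε'
  refine ⟨?_, HasFDerivAt.hasFDerivWithinAt (hs.congr_of_eventuallyEq ?_)⟩
  · have hc : ∀ᶠ ε' : CotangentBundle I N in 𝓝 ε, ε'.proj ∈ (chartAt H ε.proj).source :=
      (FiberBundle.continuous_proj _ _).continuousAt.eventually
        ((chartAt H ε.proj).open_source.mem_nhds hε)
    have hw : localSection h ε.proj (cotChart I ε.proj ε) ∈ (cotChart I.tangent a).target := by
      rw [← halpha ε hε]
      exact (cotChart I.tangent a).map_source (alpha_mem_source hε)
    have h0 : ContinuousAt (fun ε' => localSection h ε.proj (cotChart I ε.proj ε')) ε :=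
      ContinuousAt.comp hs.continuousAt (cotChart_contMDiffAt hε).continuousAt
    have h1 : ContinuousAt (fun ε' => (cotChart I.tangent a).symm
        (localSection h ε.proj (cotChart I ε.proj ε'))) ε :=
      ContinuousAt.comp (f := fun ε' => localSection h ε.proj (cotChart I ε.proj ε'))
        (cotChart_symm_contMDiffAt hw).continuousAt h0
    refine h1.congr ?_
    filter_upwards [hc] with ε' hε'
    rw [← halpha ε' hε']
    exact (cotChart I.tangent a).left_inv (alpha_mem_source hε')
  · filter_upwards [(isOpen_cotChart_target I ε.proj).mem_nhds hz] with w hw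
    have h2 := halpha _ (cotChart_symm_mem hw)
    rw [(cotChart I ε.proj).right_inv hw] at h2
    exact h2

/-- The image of the Hamiltonian vector field under Tulczyjew's map is Lagrangian. -/
theorem isLagrangianSubmanifold_alpha_image (hh : ContMDiff (cotModel I) 𝓘(ℝ, ℝ) ∞ h)
    (hX : IsHamiltonianVectorField I h X) :
    IsLagrangianSubmanifold (cotModel I.tangent) (canonicalForm I.tangent)
      (alpha I '' vectorFieldImage (cotModel I) X) := by
  have hmem : ∀ μ, μ ∈ alpha I '' vectorFieldImage (cotModel I) X ↔
      ∃ ε, alpha I ⟨ε, X ε⟩ = μ := by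
    intro μ
    constructor
    · rintro ⟨_, ⟨ε, rfl⟩, rfl⟩
      exact ⟨ε, rfl⟩
    · rintro ⟨ε, rfl⟩
      exact ⟨_, ⟨ε, rfl⟩, rfl⟩
  intro μ₀ _
  let a : TangentBundle I N := μ₀.proj
  let q : N := a.proj
  -- Following the induced chart by this shear sends α(X(ε)) to `sliceIncl` of the chart coordinates
  -- of ε.
  let A : OpenPartialHomeomorph ((E × E) × ((E × E) →L[ℝ] ℝ)) ((E × E) × ((E × E) →L[ℝ] ℝ)) :=
    OpenPartialHomeomorph.shear (sliceProj E) (localShear h q) (cotChart I q).target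
      (isOpen_cotChart_target I q)
      (fun z hz => (localShear_contDiffAt hh hz).continuousAt.continuousWithinAt)
      (sliceProj_localShear h q)
  have hsm : ContDiffOn ℝ ∞ (fun w => localShear h q (sliceProj E w))
      (sliceProj E ⁻¹' (cotChart I q).target) := fun w hw =>
    ((localShear_contDiffAt hh hw).comp w (sliceProj E).contDiff.contDiffAt).contDiffWithinAt
  have hA : ContDiffOn ℝ ∞ A A.source := contDiffOn_id.sub hsm
  have hA' : ContDiffOn ℝ ∞ A.symm A.target := contDiffOn_id.add hsm
  obtain ⟨e, he, hes, hex⟩ := exists_chart_trans (I := cotModel I.tangent)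
    (IsManifold.chart_mem_maximalAtlas μ₀) A hA hA'
  have hexA : ∀ μ, e.extend (cotModel I.tangent) μ = A (cotChart I.tangent a μ) := hex
  have hesrc : e.source = (cotChart I.tangent a).source ∩
      cotChart I.tangent a ⁻¹' A.source := by
    rw [hes, ← extChartAt_source (cotModel I.tangent)]
    rfl
  have hAs : ∀ z, A (localSection h q z) = sliceIncl E z := by
    intro z
    change localSection h q z - localShear h q (sliceProj E (localSection h q z)) = _
    rw [sliceProj_localSection, localSection_eq, add_sub_cancel_right]
  have hproj : ∀ ε, alpha I ⟨ε, X ε⟩ ∈ (cotChart I.tangent a).source →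
      ε.proj ∈ (chartAt H q).source := by
    intro ε hε
    rw [mem_cotChart_source] at hε
    exact (TangentBundle.mem_chart_source_iff _ _).1 hε
  have hslice : ∀ ε : CotangentBundle I N, ε.proj ∈ (chartAt H q).source →
      e.extend (cotModel I.tangent) (alpha I ⟨ε, X ε⟩) = sliceIncl E (cotChart I q ε) := by
    intro ε hε
    rw [hexA, cotChart_alpha hh hX a hε, hAs]
  refine ⟨e, he, ?_, LinearMap.range (sliceIncl E).toLinearMap, finrank_range_sliceIncl E, ?_, ?_⟩
  · obtain ⟨ε, hε⟩ := (hmem μ₀).1 ‹_›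
    have h1 : μ₀ ∈ (cotChart I.tangent a).source :=
      (mem_cotChart_source I.tangent).2 (mem_chart_source _ _)
    rw [hesrc]
    refine ⟨h1, ?_⟩
    rw [← hε] at h1
    have h2 := hproj ε h1
    rw [mem_preimage, ← hε, cotChart_alpha hh hX a h2]
    change sliceProj E _ ∈ (cotChart I q).target
    rw [sliceProj_localSection]
    exact cotChart_mem_target h2
  · intro μ hμ
    rw [hesrc] at hμ
    rw [hmem]
    constructor
    · rintro ⟨ε, rfl⟩
      exact ⟨_, (hslice ε (hproj ε hμ.1)).symm⟩
    · rintro ⟨z, hz⟩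
      have h1 : sliceIncl E z = A (cotChart I.tangent a μ) := hz.trans (hexA μ)
      -- The shear preserves the (x, p)-coordinates, so `z` lies in the chart target and is the
      -- coordinate pair of a covector, the required preimage.
      have h2 : sliceProj E (A (cotChart I.tangent a μ)) ∈ (cotChart I q).target :=
        A.map_source hμ.2
      rw [← h1, sliceProj_sliceIncl] at h2
      have h3 := cotChart_symm_mem h2
      refine ⟨(cotChart I q).symm z, ?_⟩
      refine (cotChart I.tangent a).injOn (alpha_mem_source h3) hμ.1 ?_
      rw [cotChart_alpha hh hX a h3, (cotChart I q).right_inv h2]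
      refine A.injOn ?_ hμ.2 ((hAs z).trans h1)
      change sliceProj E _ ∈ (cotChart I q).target
      rwa [sliceProj_localSection]
  · intro μ hμ hμS u v hu hv
    obtain ⟨ε, rfl⟩ := (hmem μ).1 hμS
    have hε : ε.proj ∈ (chartAt H q).source := hproj ε (hesrc ▸ hμ).1
    let u' : (E × E) × ((E × E) →L[ℝ] ℝ) := u
    let v' : (E × E) × ((E × E) →L[ℝ] ℝ) := v
    let De : ((E × E) × ((E × E) →L[ℝ] ℝ)) →L[ℝ] (E × E) × ((E × E) →L[ℝ] ℝ) :=
      mfderiv (cotModel I.tangent) 𝓘(ℝ, (E × E) × ((E × E) →L[ℝ] ℝ))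
        (e.extend (cotModel I.tangent)) (alpha I ⟨ε, X ε⟩)
    let Dc : (E × (E →L[ℝ] ℝ)) →L[ℝ] E × (E →L[ℝ] ℝ) :=
      mfderiv (cotModel I) 𝓘(ℝ, E × (E →L[ℝ] ℝ)) (cotChart I q) ε
    let DΦ := localSectionDeriv h ε.proj (cotChart I ε.proj ε)
    have hDe : HasMFDerivAt (cotModel I.tangent) 𝓘(ℝ, (E × E) × ((E × E) →L[ℝ] ℝ))
        (e.extend (cotModel I.tangent)) (alpha I ⟨ε, X ε⟩) De :=
      ((e.contMDiffAt_extend he hμ).mdifferentiableAt (by simp)).hasMFDerivAt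
    have hDc : HasMFDerivAt (cotModel I) 𝓘(ℝ, E × (E →L[ℝ] ℝ)) (cotChart I q) ε Dc :=
      ((cotChart_contMDiffAt hε).mdifferentiableAt (by simp)).hasMFDerivAt
    have h1 := hDe.comp ε (hasMFDerivAt_alpha hh hX ε)
    have h2 := (sliceIncl E).hasFDerivAt.hasMFDerivAt.comp ε hDc
    -- Derivative of the identity `hslice`. With `Dc` onto and `De` injective it shows that every
    -- vector sent into the slice is tangent to the image of α ∘ X.
    have hcomp : De.comp DΦ = (sliceIncl E).comp Dc := by
      refine hasMFDerivAt_unique h1 (h2.congr_of_eventuallyEq ?_)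
      have hc : ∀ᶠ ε' : CotangentBundle I N in 𝓝 ε, ε'.proj ∈ (chartAt H q).source :=
        (FiberBundle.continuous_proj _ _).continuousAt.eventually
          ((chartAt H q).open_source.mem_nhds hε)
      filter_upwards [hc] with ε' hε' using hslice ε' hε'
    have hsurj : Function.Surjective Dc :=
      (isInvertible_mfderiv_extChartAt ((mem_cotChart_source I).2 hε)).bijective.surjective
    have hinj : Function.Injective De := mfderiv_extend_injective he (by simp) hμ
    have key : ∀ w : (E × E) × ((E × E) →L[ℝ] ℝ),
        De w ∈ LinearMap.range (sliceIncl E).toLinearMap → ∃ δ, w = DΦ δ := by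
      rintro w ⟨z, hz⟩
      obtain ⟨δ, rfl⟩ := hsurj z
      refine ⟨δ, hinj ?_⟩
      have h3 := congrArg (fun L => L δ) hcomp
      exact hz.symm.trans h3.symm
    obtain ⟨δ, hδ⟩ := key u' hu
    obtain ⟨δ', hδ'⟩ := key v' hv
    have h4 : canonicalForm I.tangent _ u v = v'.2 u'.1 - u'.2 v'.1 :=
      canonicalForm_apply I.tangent _ u v
    rw [h4, hδ, hδ']
    exact localSectionDeriv_isotropic hh (cotChart_mem_target (mem_chart_source H _)) δ δ'

end Tulczyjew

end

theorem theorem4p1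
    {E : Type*} [NormedAddCommGroup E] [NormedSpace ℝ E] [FiniteDimensional ℝ E]
    {M : Type*} [TopologicalSpace M] [ChartedSpace E M] [IsManifold 𝓘(ℝ, E) ∞ M]
    {F : Type*} [NormedAddCommGroup F] [NormedSpace ℝ F] [FiniteDimensional ℝ F]
    {C : Type*} [TopologicalSpace C] [ChartedSpace F C] [IsManifold 𝓘(ℝ, F) ∞ C]
    (h : CotangentBundle 𝓘(ℝ, E) M → ℝ)
    (hh : ContMDiff (cotModel 𝓘(ℝ, E)) 𝓘(ℝ, ℝ) ∞ h)
    (ι : C → TangentBundle 𝓘(ℝ, E) M) (Fh : CotangentBundle 𝓘(ℝ, E) M → C)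
    (hreg : IsAlmostRegular 𝓘(ℝ, E) 𝓘(ℝ, F) h ι Fh) :
    (∃! X : ∀ ε : CotangentBundle 𝓘(ℝ, E) M, TangentSpace (cotModel 𝓘(ℝ, E)) ε,
      IsHamiltonianVectorField 𝓘(ℝ, E) h X) ∧
    (∃! L : C → ℝ, ∀ ε, L (Fh ε) = dilationDeriv 𝓘(ℝ, E) h ε - h ε) ∧
    ∀ (X : ∀ ε : CotangentBundle 𝓘(ℝ, E) M, TangentSpace (cotModel 𝓘(ℝ, E)) ε) (L : C → ℝ),
      IsHamiltonianVectorField 𝓘(ℝ, E) h X →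
      (∀ ε, L (Fh ε) = dilationDeriv 𝓘(ℝ, E) h ε - h ε) →
      ContMDiff 𝓘(ℝ, F) 𝓘(ℝ, ℝ) ∞ L ∧
      IsLagrangianSubmanifold (cotModel 𝓘(ℝ, E).tangent) (canonicalForm 𝓘(ℝ, E).tangent)
        (generatedSet 𝓘(ℝ, E).tangent 𝓘(ℝ, F) ι L) ∧
      alpha 𝓘(ℝ, E) '' vectorFieldImage (cotModel 𝓘(ℝ, E)) X =
        generatedSet 𝓘(ℝ, E).tangent 𝓘(ℝ, F) ι L ∧
      alpha 𝓘(ℝ, E) ⁻¹' generatedSet 𝓘(ℝ, E).tangent 𝓘(ℝ, F) ι L =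
        vectorFieldImage (cotModel 𝓘(ℝ, E)) X := by
  refine ⟨⟨fun ε => ((velPart h ε.proj (cotChart 𝓘(ℝ, E) ε.proj ε),
      -basePart h ε.proj (cotChart 𝓘(ℝ, E) ε.proj ε)) : E × (E →L[ℝ] ℝ)),
      (isHamiltonianVectorField_iff hh _).2 fun _ => rfl,
      fun X hX => funext ((isHamiltonianVectorField_iff hh X).1 hX)⟩,
    hreg.exists_descent hh, fun X L hX hL => ?_⟩
  have himage := hreg.alpha_image_eq_generatedSet hh hX hL
  refine ⟨hreg.contMDiff_descent hh hL, ?_, himage, ?_⟩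
  · rw [← himage]
    exact isLagrangianSubmanifold_alpha_image hh hX
  · rw [← himage, preimage_image_eq _ alpha_injective]
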